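/- Let $V$ be a locally small category. The category $\mathcal{G}V$ of graphs enriched in $V$ is defined as follows. An object $X$ consists of a (small) set $X_0$ and an object $X(a,b)$ of $V$ for each ordered pair $(a,b)$ of elements of $X_0$. A morphism $f:X\to Y$ consists of a function $f_0:X_0\to Y_0$ and morphisms $f_{a,b}:X(a,b)\to Y(f_0a,f_0b)$ of $V$ for all $a,b\in X_0$. Write $\mathcal{G}^2V=\mathcal{G}(\mathcal{G}V)$. Let $\lambda$ be a regular cardinal. An object $C$ of a category is connected when the representable $\mathrm{Hom}(C,-)$ preserves small coproducts, and $\lambda$-presentable when $\mathrm{Hom}(C,-)$ preserves $\lambda$-filtered colimits. A category $\mathcal{A}$ is $\lambda$-c-filtered when every functor $J\to\mathcal{A}$ with $J$ connected (in particular non-empty) and with fewer than $\lambda$ arrows admits a cocone. A locally small category is locally $\lambda$-presentable (respectively locally $\lambda$-c-presentable) when it is cocomplete and has a small set $\mathcal{S}$ of $\lambda$-presentable (respectively connected and $\lambda$-presentable) objects such that every object is a $\lambda$-filtered (respectively $\lambda$-c-filtered) colimit of objects of $\mathcal{S}$. An initial object is strict when every morphism into it is an isomorphism. A presheaf topos is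 a category equivalent to the category of presheaves of sets on a small category; a Grothendieck topos is a category equivalent to the category of sheaves of sets on a small site; it is locally connected when the left adjoint $I\mapsto\coprod_{i\in I}1$ of its global sections functor $\mathrm{Hom}(1,-)$ to $\mathbf{Set}$ itself has a left adjoint. Theorem. 1. If $V$ is locally $\lambda$-presentable then so is $\mathcal{G}V$. 2. If $V$ is locally $\lambda$-presentable and has a strict initial object, then $\mathcal{G}V$ is locally $\lambda$-c-presentable. 3. If $V$ is locally $\lambda$-presentable then $\mathcal{G}^2V$ is locally $\lambda$-c-presentable. 4. If $V$ is locally $\lambda$-c-presentable then so is $\mathcal{G}V$. 5. If $V$ is a presheaf topos then so is $\mathcal{G}V$. 6. If $V$ is a Grothendieck topos then $\mathcal{G}V$ is a locally connected Grothendieck topos. -/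

import Mathlib

open CategoryTheory Limits Opposite

universe w u

/-- A graph enriched in `V`: a (small) set of objects, and an object `hom a b` of `V` for each
ordered pair `(a, b)` of objects. -/
structure EnrichedGraph (V : Type u) : Type (max u (w + 1)) where
  obj : Type w
  hom : obj → obj → V

namespace EnrichedGraph

variable {V : Type u} [Category.{w} V]

/-- A morphism of `V`-graphs: an object function and hom maps `X(a, b) ⟶ Y(f a, f b)`. -/
@[ext]
structure Hom (X Y : EnrichedGraph.{w} V) : Type w where
  obj : X.obj → Y.obj
  map (a b : X.obj) : X.hom a b ⟶ Y.hom (obj a) (obj b)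

/-- The category `𝒢V` of `V`-graphs, for a locally small category `V`. -/
instance : Category.{w} (EnrichedGraph.{w} V) where
  Hom X Y := Hom X Y
  id X := { obj := fun a => a, map := fun a b => 𝟙 (X.hom a b) }
  comp f g :=
    { obj := fun a => g.obj (f.obj a)
      map := fun a b => f.map a b ≫ g.map (f.obj a) (f.obj b) }
  id_comp f := by
    cases f
    simp
  comp_id f := by
    cases f
    simp
  assoc f g h := by
    simp

end EnrichedGraph

section CPresentable

variable (C : Type u) [Category.{w} C]

/-- The connected objects `X` of `C`: those for which the representable `C(X, -)` preserves
(small) coproducts. -/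
def isConnectedObject : ObjectProperty C := fun X =>
  ∀ I : Type w, PreservesColimitsOfShape (Discrete I) (coyoneda.obj (op X))

/-- A category `J` is `κ`-c-filtered when every functor `A ⥤ J` from a `κ`-small connected
category `A` admits a cocone. (Connected categories are nonempty.) -/
class IsCardinalCFiltered (J : Type w) [SmallCategory J]
    (κ : Cardinal.{w}) [Fact κ.IsRegular] : Prop where
  nonempty_cocone {A : Type w} [SmallCategory A] [IsConnected A] (F : A ⥤ J)
    (hA : HasCardinalLT (Arrow A) κ) : Nonempty (Cocone F)

/-- A (locally small) category `C` is locally `κ`-c-presentable when it is cocomplete and there is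
a small set of connected `κ`-presentable objects such that every object of `C` is a
`κ`-c-filtered colimit of objects in this set. -/
class IsCardinalLocallyCPresentable (κ : Cardinal.{w}) [Fact κ.IsRegular] : Prop
    extends HasColimitsOfSize.{w, w} C where
  exists_generator : ∃ (S : ObjectProperty C) (_ : ObjectProperty.Small.{w} S),
    S ≤ isConnectedObject C ∧ S ≤ isCardinalPresentable C κ ∧
      ∀ X : C, ∃ (J : Type w) (_ : SmallCategory J) (_ : IsCardinalCFiltered J κ),
        S.colimitsOfShape J X

end CPresentable

section Toposes

variable (C : Type u) [Category.{w} C]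

/-- `C` is equivalent to the category of presheaves of sets on a small category. -/
def IsPresheafTopos : Prop :=
  ∃ (D : Type w) (_ : SmallCategory D), Nonempty (C ≌ (Dᵒᵖ ⥤ Type w))

/-- `C` is equivalent to the category of sheaves of sets on a small site. -/
def IsGrothendieckTopos : Prop :=
  ∃ (D : Type w) (_ : SmallCategory D) (J : GrothendieckTopology D),
    Nonempty (C ≌ Sheaf J (Type w))

/-- `C` is a Grothendieck topos which is locally connected: the left adjoint `Δ` of the global
sections functor `C(1, -) : C ⥤ Set`, that is the functor `I ↦ ∐ i : I, 1`, has itself a left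
adjoint. -/
def IsLocallyConnectedGrothendieckTopos : Prop :=
  IsGrothendieckTopos C ∧
    ∃ (T : C) (_ : IsTerminal T) (Δ : Type w ⥤ C) (_ : Δ ⊣ coyoneda.obj (op T)),
      Δ.IsRightAdjoint

end Toposes

/-! Everything rests on two kinds of representable functor on `𝒢V`: the set of vertices,
corepresented by `point V`, and the set of `C`-shaped edges, corepresented by `edgeGraph C`, whose
only non-initial hom can be `C`. A colimit of graphs has as vertices the colimit `Q` of the vertex
sets, and its hom from `x` to `y` is the colimit in `V` of the homs `F j (a, b)` over all pairs `(a,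
b)` lying above `(x, y)`. So `edges C` preserves a colimit as soon as `Hom(C, -)` preserves these
colimits indexed by `EdgeIndex` (`preservesColimit_edges`).

If the diagram is `κ`-filtered, so is each `EdgeIndex`; hence `edgeGraph C` is `κ`-presentable when
`C` is. If the diagram is discrete, each `EdgeIndex` is empty or has a terminal object; hence
`edgeGraph C` is connected when the initial object of `V` is strict and `C` is not initial. If `P`
is dense in `V`, then the point and the edge graphs on `P` are dense in `𝒢V`
(`isDense_of_edgeGraph`), and under strictness the initial members of `P` can be dropped. Dense
connected presentable objects give local c-presentability, because they are closed under small
connected colimits (`isCardinalLocallyCPresentable_of_isDense`). The claim on `𝒢²V` follows since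
the initial graph is always strict, and the claim on c-presentable `V` since c-presentability forces
strictness.

For toposes, adjoin to the site `D` an object with two maps to each object of `D`. Graphs enriched
in presheaves on `D` are then presheaves on `WithVertex D`, by splitting the elements over `c`
according to their endpoints, and sheaf conditions correspond (`isSheaf_topology_iff`). Local
connectedness is witnessed by the set of connected components of a graph, left adjoint to the
discrete graph functor. -/

namespace EnrichedGraph

/-! ### Edges of enriched graphs -/

variable {V : Type u} [Category.{w} V]

@[simp]
lemma id_obj (X : EnrichedGraph.{w} V) (a : X.obj) : Hom.obj (𝟙 X) a = a := rfl

@[simp]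
lemma id_map (X : EnrichedGraph.{w} V) (a b : X.obj) : Hom.map (𝟙 X) a b = 𝟙 (X.hom a b) := rfl

@[simp]
lemma comp_obj {X Y Z : EnrichedGraph.{w} V} (f : X ⟶ Y) (g : Y ⟶ Z) (a : X.obj) :
    (f ≫ g).obj a = g.obj (f.obj a) := rfl

@[simp]
lemma comp_map {X Y Z : EnrichedGraph.{w} V} (f : X ⟶ Y) (g : Y ⟶ Z) (a b : X.obj) :
    (f ≫ g).map a b = f.map a b ≫ g.map (f.obj a) (f.obj b) := rfl

/-- A `C`-shaped edge of a `V`-graph `X`: a pair of vertices and a morphism from `C` to the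
corresponding hom object. -/
structure Edge (C : V) (X : EnrichedGraph.{w} V) : Type w where
  /-- the source vertex -/
  src : X.obj
  /-- the target vertex -/
  tgt : X.obj
  /-- the underlying morphism -/
  hom : C ⟶ X.hom src tgt

namespace Edge

/-- The image of an edge under a morphism of graphs. -/
@[simps]
def map {C : V} {X Y : EnrichedGraph.{w} V} (f : X ⟶ Y) (e : Edge C X) : Edge C Y where
  src := f.obj e.src
  tgt := f.obj e.tgt
  hom := e.hom ≫ f.map e.src e.tgt

/-- The restriction of an edge along a morphism of shapes. -/
@[simps]
def precomp {C D : V} (u : C ⟶ D) {X : EnrichedGraph.{w} V} (e : Edge D X) : Edge C X where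
  src := e.src
  tgt := e.tgt
  hom := u ≫ e.hom

/-- Bundling a morphism with its endpoints lets equations be stated when endpoints agree only
propositionally; this lemma returns to `V` once the endpoints are literally the same. Most hom
computations below take this route. -/
lemma hom_injective {C : V} {X : EnrichedGraph.{w} V} {a b : X.obj} {g g' : C ⟶ X.hom a b}
    (h : Edge.mk a b g = Edge.mk a b g') : g = g' := by
  simpa using h

/-- The underlying morphism of an edge, when its vertices are known up to equality. -/
def homOfEq {C : V} {X : EnrichedGraph.{w} V} (e : Edge C X) {a b : X.obj}
    (ha : e.src = a) (hb : e.tgt = b) : C ⟶ X.hom a b :=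
  e.hom ≫ eqToHom (by rw [ha, hb])

lemma mk_homOfEq {C : V} {X : EnrichedGraph.{w} V} (e : Edge C X) {a b : X.obj}
    (ha : e.src = a) (hb : e.tgt = b) : Edge.mk a b (e.homOfEq ha hb) = e := by
  subst ha hb
  simp [homOfEq]

/-- The hom map of a morphism of graphs, when the images of the vertices are known up to
equality. -/
def mapEq {X Y : EnrichedGraph.{w} V} (f : X ⟶ Y) {a b : X.obj} {a' b' : Y.obj}
    (ha : f.obj a = a') (hb : f.obj b = b') : X.hom a b ⟶ Y.hom a' b' :=
  f.map a b ≫ eqToHom (by rw [ha, hb])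

lemma mk_comp_mapEq {X Y : EnrichedGraph.{w} V} (f : X ⟶ Y) {a b : X.obj} {a' b' : Y.obj}
    (ha : f.obj a = a') (hb : f.obj b = b') {C : V} (g : C ⟶ X.hom a b) :
    Edge.mk a' b' (g ≫ mapEq f ha hb) = (Edge.mk a b g).map f := by
  subst ha hb
  simp [mapEq, map]

lemma mk_mapEq {X Y : EnrichedGraph.{w} V} (f : X ⟶ Y) {a b : X.obj} {a' b' : Y.obj}
    (ha : f.obj a = a') (hb : f.obj b = b') :
    Edge.mk a' b' (mapEq f ha hb) = (Edge.mk a b (𝟙 _)).map f := by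
  rw [← mk_comp_mapEq f ha hb, Category.id_comp]

lemma mk_comp {C D : V} {X : EnrichedGraph.{w} V} {a b : X.obj} (u : C ⟶ D) (g : D ⟶ X.hom a b) :
    Edge.mk a b (u ≫ g) = (Edge.mk a b g).precomp u := rfl

lemma precomp_map {C D : V} {X Y : EnrichedGraph.{w} V} (u : C ⟶ D) (e : Edge D X) (f : X ⟶ Y) :
    (e.precomp u).map f = (e.map f).precomp u := by
  simp [map, precomp]

lemma map_comp {C : V} {X Y Z : EnrichedGraph.{w} V} (f : X ⟶ Y) (g : Y ⟶ Z) (e : Edge C X) :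
    e.map (f ≫ g) = (e.map f).map g := by
  simp [map]

lemma map_id {C : V} {X : EnrichedGraph.{w} V} (e : Edge C X) :
    e.map (𝟙 X) = e := by
  simp [map]

end Edge

/-- By the Yoneda argument, the identity of `X.hom a b` is the universal edge from `a` to `b`. -/
lemma hom_ext_edge {X Y : EnrichedGraph.{w} V} {f g : X ⟶ Y} (h₀ : ∀ a, f.obj a = g.obj a)
    (h : ∀ a b, Edge.map f (Edge.mk a b (𝟙 _)) = Edge.map g (Edge.mk a b (𝟙 _))) : f = g := by
  obtain ⟨f₀, f₁⟩ := f
  obtain ⟨g₀, g₁⟩ := g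
  obtain rfl : f₀ = g₀ := funext h₀
  congr
  ext a b
  simpa [Edge.map] using h a b

lemma hom_ext_mapEq {X Y : EnrichedGraph.{w} V} {f g : X ⟶ Y} (h₀ : ∀ a, f.obj a = g.obj a)
    (h : ∀ a b, Edge.mapEq f (h₀ a) (h₀ b) = g.map a b) : f = g :=
  hom_ext_edge h₀ (fun a b => by
    rw [← Edge.mk_mapEq f (h₀ a) (h₀ b), h]
    simp [Edge.map])

variable (V) in
/-- The functor sending a `V`-graph to its set of vertices. -/
@[simps]
def vertices : EnrichedGraph.{w} V ⥤ Type w where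
  obj X := X.obj
  map f := ↾f.obj

/-- The functor sending a `V`-graph to its set of `C`-shaped edges. -/
@[simps]
def edges (C : V) : EnrichedGraph.{w} V ⥤ Type w where
  obj X := Edge C X
  map f := ↾(Edge.map f)
  map_id X := by ext ⟨a, b, e⟩; simp [Edge.map]
  map_comp f g := by ext ⟨a, b, e⟩; simp [Edge.map]

/-! ### Graphs corepresenting vertices and edges -/

section Representing

variable [HasInitial V]

variable (V) in
/-- The graph with one vertex, whose hom is initial. -/
noncomputable def point : EnrichedGraph.{w} V where
  obj := PUnit
  hom _ _ := ⊥_ V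

/-- The hom objects of `edgeGraph C`. -/
noncomputable def edgeGraphHom (C : V) : ULift.{w} Bool → ULift.{w} Bool → V
  | ⟨false⟩, ⟨true⟩ => C
  | _, _ => ⊥_ V

/-- The graph with two vertices, whose only non trivial hom object is `C`. -/
noncomputable def edgeGraph (C : V) : EnrichedGraph.{w} V where
  obj := ULift Bool
  hom := edgeGraphHom C

/-- Morphisms from `point` are vertices. -/
noncomputable def pointHom {X : EnrichedGraph.{w} V} (a : X.obj) : point V ⟶ X where
  obj _ := a
  map _ _ := initial.to _

/-- The hom maps of `edgeHom`. -/
noncomputable def edgeHomMap {C : V} {X : EnrichedGraph.{w} V} (e : Edge C X) :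
    ∀ i j : ULift.{w} Bool, edgeGraphHom C i j ⟶
      X.hom (bif i.down then e.tgt else e.src) (bif j.down then e.tgt else e.src)
  | ⟨false⟩, ⟨true⟩ => e.hom
  | ⟨false⟩, ⟨false⟩ => initial.to _
  | ⟨true⟩, ⟨false⟩ => initial.to _
  | ⟨true⟩, ⟨true⟩ => initial.to _

/-- Morphisms from `edgeGraph C` are `C`-shaped edges. -/
noncomputable def edgeHom {C : V} {X : EnrichedGraph.{w} V} (e : Edge C X) : edgeGraph C ⟶ X where
  obj i := bif i.down then e.tgt else e.src
  map := edgeHomMap e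

/-- The `C`-shaped edge of a graph given by a morphism from `edgeGraph C`. -/
def edgeOfHom {C : V} {X : EnrichedGraph.{w} V} (f : edgeGraph C ⟶ X) : Edge C X where
  src := f.obj ⟨false⟩
  tgt := f.obj ⟨true⟩
  hom := f.map ⟨false⟩ ⟨true⟩

@[simp]
lemma edgeOfHom_edgeHom {C : V} {X : EnrichedGraph.{w} V} (e : Edge C X) :
    edgeOfHom (edgeHom e) = e := rfl

lemma edgeOfHom_comp {C : V} {X Y : EnrichedGraph.{w} V} (f : edgeGraph C ⟶ X) (g : X ⟶ Y) :
    edgeOfHom (f ≫ g) = (edgeOfHom f).map g := rfl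

lemma edgeOfHom_injective {C : V} {X : EnrichedGraph.{w} V} {f g : edgeGraph C ⟶ X}
    (h : edgeOfHom f = edgeOfHom g) : f = g := by
  obtain ⟨f₀, f₁⟩ := f
  obtain ⟨g₀, g₁⟩ := g
  dsimp [edgeOfHom] at h
  obtain rfl : f₀ = g₀ := by
    ext ⟨_ | _⟩
    · exact congr_arg Edge.src h
    · exact congr_arg Edge.tgt h
  congr
  ext ⟨_ | _⟩ ⟨_ | _⟩
  · exact initialIsInitial.hom_ext _ _
  · exact Edge.hom_injective h
  · exact initialIsInitial.hom_ext _ _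
  · exact initialIsInitial.hom_ext _ _

lemma pointHom_ext {X : EnrichedGraph.{w} V} {f g : point V ⟶ X}
    (h : f.obj ⟨⟩ = g.obj ⟨⟩) : f = g := by
  obtain ⟨f₀, f₁⟩ := f
  obtain ⟨g₀, g₁⟩ := g
  obtain rfl : f₀ = g₀ := by
    ext ⟨⟩
    exact h
  congr
  ext
  exact initialIsInitial.hom_ext _ _

lemma pointHom_comp {X Y : EnrichedGraph.{w} V} (a : X.obj) (f : X ⟶ Y) :
    pointHom a ≫ f = pointHom (f.obj a) := pointHom_ext rfl

lemma edgeHom_comp {C : V} {X Y : EnrichedGraph.{w} V} (e : Edge C X) (f : X ⟶ Y) :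
    edgeHom e ≫ f = edgeHom (e.map f) := edgeOfHom_injective rfl

lemma edgeHom_edgeOfHom {C : V} {X : EnrichedGraph.{w} V} (f : edgeGraph C ⟶ X) :
    edgeHom (edgeOfHom f) = f := edgeOfHom_injective rfl

/-- The vertex functor is corepresented by `point`. -/
noncomputable def coyonedaPointIso : vertices V ≅ coyoneda.obj (op (point V)) :=
  NatIso.ofComponents (fun X => Equiv.toIso
    { toFun := pointHom
      invFun f := f.obj ⟨⟩
      left_inv _ := rfl
      right_inv _ := pointHom_ext rfl }) (fun f => by
        ext a
        exact (pointHom_comp a f).symm)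

/-- The functor of `C`-shaped edges is corepresented by `edgeGraph C`. -/
noncomputable def coyonedaEdgeIso (C : V) : edges C ≅ coyoneda.obj (op (edgeGraph C)) :=
  NatIso.ofComponents (fun (X : EnrichedGraph.{w} V) => Equiv.toIso
    { toFun e := edgeHom e
      invFun f := edgeOfHom f
      left_inv _ := rfl
      right_inv _ := edgeOfHom_injective rfl }) (fun {X Y} (f : X ⟶ Y) => by
        ext e
        exact (edgeHom_comp e f).symm)

/-- Functoriality of `edgeGraph`. -/
noncomputable def edgeGraphMap {C D : V} (u : C ⟶ D) : edgeGraph C ⟶ edgeGraph D :=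
  edgeHom ((edgeOfHom (𝟙 (edgeGraph D))).precomp u)

lemma edgeGraphMap_comp {C D : V} (u : C ⟶ D) {X : EnrichedGraph.{w} V} (e : Edge D X) :
    edgeGraphMap u ≫ edgeHom e = edgeHom (e.precomp u) := by
  apply edgeOfHom_injective
  rw [edgeGraphMap, edgeOfHom_comp, edgeOfHom_edgeHom, Edge.precomp_map, ← edgeOfHom_comp,
    Category.id_comp, edgeOfHom_edgeHom, edgeOfHom_edgeHom]

end Representing

end EnrichedGraph

/-! ### Colimits of enriched graphs -/

namespace EnrichedGraph

variable {V : Type u} [Category.{w} V]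

section Colimits

variable {J : Type w} [SmallCategory J] {F : J ⥤ EnrichedGraph.{w} V} {Q : Type w}
  (q : ∀ j, (F.obj j).obj → Q)

/-- The pairs of vertices of the graphs `F.obj j` mapping to a given pair `(x, y)`. -/
structure EdgeIndex (x y : Q) : Type w where
  /-- the index -/
  idx : J
  /-- the source -/
  src : (F.obj idx).obj
  /-- the target -/
  tgt : (F.obj idx).obj
  hsrc : q idx src = x
  htgt : q idx tgt = y

namespace EdgeIndex

variable {q} {x y : Q}

/-- Morphisms of pairs of vertices. -/
@[ext]
structure Hom (e e' : EdgeIndex q x y) : Type w where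
  /-- the morphism of indices -/
  hom : e.idx ⟶ e'.idx
  hsrc : (F.map hom).obj e.src = e'.src
  htgt : (F.map hom).obj e.tgt = e'.tgt

instance : SmallCategory (EdgeIndex q x y) where
  Hom := Hom
  id e := { hom := 𝟙 _, hsrc := by simp, htgt := by simp }
  comp f g :=
    { hom := f.hom ≫ g.hom
      hsrc := by simp [f.hsrc, g.hsrc]
      htgt := by simp [f.htgt, g.htgt] }

@[simp] lemma id_hom (e : EdgeIndex q x y) : Hom.hom (𝟙 e) = 𝟙 _ := rfl

@[simp] lemma comp_hom {e e' e'' : EdgeIndex q x y} (f : e ⟶ e') (g : e' ⟶ e'') :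
    (f ≫ g).hom = f.hom ≫ g.hom := rfl

/-- The transition maps of `diagram`. -/
def diagramMap {e e' : EdgeIndex q x y} (f : e ⟶ e') :
    (F.obj e.idx).hom e.src e.tgt ⟶ (F.obj e'.idx).hom e'.src e'.tgt :=
  Edge.mapEq (F.map f.hom) f.hsrc f.htgt

lemma mk_comp_diagramMap {e e' : EdgeIndex q x y} (f : e ⟶ e')
    {C : V} (g : C ⟶ (F.obj e.idx).hom e.src e.tgt) :
    Edge.mk e'.src e'.tgt (g ≫ diagramMap f) = (Edge.mk e.src e.tgt g).map (F.map f.hom) :=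
  Edge.mk_comp_mapEq _ _ _ _

lemma mk_diagramMap {e e' : EdgeIndex q x y} (f : e ⟶ e') :
    Edge.mk e'.src e'.tgt (diagramMap f) = (Edge.mk e.src e.tgt (𝟙 _)).map (F.map f.hom) :=
  Edge.mk_mapEq _ _ _

variable (q x y) in
/-- The diagram of hom objects whose colimit is the hom object of a colimit of graphs. -/
@[simps]
def diagram : EdgeIndex q x y ⥤ V where
  obj e := (F.obj e.idx).hom e.src e.tgt
  map f := diagramMap f
  map_id e := by
    apply Edge.hom_injective
    rw [mk_diagramMap, id_hom, F.map_id, Edge.map_id]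
  map_comp {e e' e''} f g := by
    apply Edge.hom_injective
    rw [mk_comp_diagramMap, mk_diagramMap, mk_diagramMap, comp_hom, F.map_comp, Edge.map_comp]

lemma map_mk_comp_diagramMap {X : EnrichedGraph.{w} V} {s : ∀ j, F.obj j ⟶ X}
    (hs : ∀ {i j} (f : i ⟶ j), F.map f ≫ s j = s i) {e e' : EdgeIndex q x y} (f : e ⟶ e')
    {C : V} (g : C ⟶ (F.obj e.idx).hom e.src e.tgt) :
    (Edge.mk e'.src e'.tgt (g ≫ diagramMap f)).map (s e'.idx) =
      (Edge.mk e.src e.tgt g).map (s e.idx) := by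
  rw [← hs f.hom, Edge.map_comp, mk_comp_diagramMap]

end EdgeIndex

/-- The cocone on the vertices of a diagram of graphs. -/
def verticesCocone (hq : ∀ {i j : J} (f : i ⟶ j) (a : (F.obj i).obj),
    q j ((F.map f).obj a) = q i a) : Cocone (F ⋙ vertices V) where
  pt := Q
  ι :=
    { app j := ↾(q j)
      naturality i j f := by
        ext a
        exact hq f a }

section

variable {q} {X : EnrichedGraph.{w} V} {s : ∀ j, F.obj j ⟶ X}
  (hs : ∀ {i j} (f : i ⟶ j), F.map f ≫ s j = s i) {d : Q → X.obj}
  (hd : ∀ j a, d (q j a) = (s j).obj a) {x y : Q}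

include hd

lemma desc_src (e : EdgeIndex q x y) : (s e.idx).obj e.src = d x := by rw [← hd, e.hsrc]

lemma desc_tgt (e : EdgeIndex q x y) : (s e.idx).obj e.tgt = d y := by rw [← hd, e.htgt]

include hs in
/-- The cocone on a diagram of hom objects induced by a cocone on a diagram of graphs. -/
@[simps]
def diagramCocone (x y : Q) : Cocone (EdgeIndex.diagram q x y) where
  pt := X.hom (d x) (d y)
  ι :=
    { app e := Edge.mapEq (s e.idx) (desc_src hd e) (desc_tgt hd e)
      naturality e e' f := by
        refine Eq.trans ?_ (Category.comp_id _).symm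
        apply Edge.hom_injective
        refine (Edge.mk_comp_mapEq (s e'.idx) (desc_src hd e') (desc_tgt hd e')
          (EdgeIndex.diagramMap f)).trans (((congr_arg (fun g => Edge.map (s e'.idx)
            (Edge.mk e'.src e'.tgt g)) (Category.id_comp _)).symm.trans
              (EdgeIndex.map_mk_comp_diagramMap hs f (𝟙 _))).trans (Edge.mk_mapEq _ _ _).symm) }

end

-- Keeping the vertex colimit abstract as `(Q, q)` means that only its universal property is used
-- afterwards.
variable (F) in
lemma exists_isColimit_verticesCocone :
    ∃ (Q : Type w) (q : ∀ j, (F.obj j).obj → Q)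
      (hq : ∀ {i j : J} (f : i ⟶ j) (a : (F.obj i).obj), q j ((F.map f).obj a) = q i a),
      Nonempty (IsColimit (verticesCocone q hq)) :=
  ⟨colimit (F ⋙ vertices V), fun j a => colimit.ι (F ⋙ vertices V) j a,
    fun f a => ConcreteCategory.congr_hom (colimit.w (F ⋙ vertices V) f) a,
    ⟨colimit.isColimit (F ⋙ vertices V)⟩⟩

variable {q} in
/-- The map on vertices induced by a cocone of graphs. -/
noncomputable def verticesDesc
    {hq : ∀ {i j : J} (f : i ⟶ j) (a : (F.obj i).obj), q j ((F.map f).obj a) = q i a}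
    (hQ : IsColimit (verticesCocone q hq)) (s : Cocone F) :
    Q → s.pt.obj :=
  hQ.desc ((vertices V).mapCocone s)

variable {q} in
lemma verticesDesc_apply
    {hq : ∀ {i j : J} (f : i ⟶ j) (a : (F.obj i).obj), q j ((F.map f).obj a) = q i a}
    (hQ : IsColimit (verticesCocone q hq)) (s : Cocone F) (j : J)
    (a : (F.obj j).obj) : verticesDesc hQ s (q j a) = (s.ι.app j).obj a :=
  ConcreteCategory.congr_hom (hQ.fac ((vertices V).mapCocone s) j) a

variable [HasColimitsOfSize.{w, w} V]

/-- The colimit of a diagram of graphs. -/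
@[simps]
noncomputable abbrev colimitGraph : EnrichedGraph.{w} V where
  obj := Q
  hom x y := colimit (EdgeIndex.diagram q x y)

/-- An index over `(x, y)` can be replaced by the canonical one over the images of its own
endpoints, where `colimitGraphι` is defined. -/
lemma mk_comp_colimit_ι {x y : Q} (e : EdgeIndex q x y) {C : V}
    (g : C ⟶ (F.obj e.idx).hom e.src e.tgt) :
    Edge.mk (X := colimitGraph q) x y (g ≫ colimit.ι (EdgeIndex.diagram q x y) e) =
      Edge.mk (X := colimitGraph q) (q e.idx e.src) (q e.idx e.tgt)
        (g ≫ colimit.ι (EdgeIndex.diagram q (q e.idx e.src) (q e.idx e.tgt))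
          ⟨e.idx, e.src, e.tgt, rfl, rfl⟩) := by
  obtain ⟨i, a, b, rfl, rfl⟩ := e
  rfl

/-- The inclusions of the colimit of a diagram of graphs. -/
@[simps]
noncomputable def colimitGraphι (j : J) : F.obj j ⟶ colimitGraph q where
  obj := q j
  map a b := colimit.ι (EdgeIndex.diagram q (q j a) (q j b)) ⟨j, a, b, rfl, rfl⟩

lemma edge_map_colimitGraphι {x y : Q} (e : EdgeIndex q x y) {C : V}
    (g : C ⟶ (F.obj e.idx).hom e.src e.tgt) :
    (Edge.mk e.src e.tgt g).map (colimitGraphι q e.idx) =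
      Edge.mk (X := colimitGraph q) x y (g ≫ colimit.ι (EdgeIndex.diagram q x y) e) :=
  (mk_comp_colimit_ι q e g).symm

variable (hq : ∀ {i j : J} (f : i ⟶ j) (a : (F.obj i).obj), q j ((F.map f).obj a) = q i a)

include hq in
lemma map_comp_colimitGraphι {i j : J} (f : i ⟶ j) :
    F.map f ≫ colimitGraphι q j = colimitGraphι q i := by
  refine hom_ext_edge (hq f) (fun a b => ?_)
  let e : EdgeIndex q (q i a) (q i b) := ⟨i, a, b, rfl, rfl⟩
  let e' : EdgeIndex q (q i a) (q i b) := ⟨j, (F.map f).obj a, (F.map f).obj b, hq f a, hq f b⟩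
  -- The pair `(a, b)` and its image under `F.map f` lie over the same pair in `Q`, and `f` itself
  -- connects them in `EdgeIndex`.
  let φ : e ⟶ e' := ⟨f, rfl, rfl⟩
  have h₁ := edge_map_colimitGraphι q e (𝟙 _)
  have h₂ := edge_map_colimitGraphι q e' (𝟙 _ ≫ EdgeIndex.diagramMap φ)
  have h₃ := EdgeIndex.mk_comp_diagramMap φ (𝟙 _)
  rw [h₃] at h₂
  rw [Edge.map_comp]
  refine h₂.trans (Eq.trans ?_ h₁.symm)
  congr 1
  rw [← colimit.w _ φ]
  exact Category.assoc _ _ _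

/-- The cocone of the colimit of a diagram of graphs. -/
@[simps]
noncomputable def colimitGraphCocone : Cocone F where
  pt := colimitGraph q
  ι :=
    { app j := colimitGraphι q j
      naturality i j f := by
        simp [map_comp_colimitGraphι q hq] }

section

variable {q} {X : EnrichedGraph.{w} V} {s : ∀ j, F.obj j ⟶ X}
  (hs : ∀ {i j} (f : i ⟶ j), F.map f ≫ s j = s i) {d : Q → X.obj}
  (hd : ∀ j a, d (q j a) = (s j).obj a)

/-- The universal property of the colimit of a diagram of graphs. -/
@[simps]
noncomputable def colimitGraphDesc : colimitGraph q ⟶ X where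
  obj := d
  map x y := colimit.desc (EdgeIndex.diagram q x y) (diagramCocone hs hd x y)

lemma edge_map_colimitGraphDesc {x y : Q}
    (e : EdgeIndex q x y) {C : V} (g : C ⟶ (F.obj e.idx).hom e.src e.tgt) :
    (Edge.mk (X := colimitGraph q) x y (g ≫ colimit.ι (EdgeIndex.diagram q x y) e)).map
      (colimitGraphDesc hs hd) = (Edge.mk e.src e.tgt g).map (s e.idx) := by
  refine Eq.trans ?_ (Edge.mk_comp_mapEq (s e.idx) (desc_src hd e) (desc_tgt hd e) g)
  refine congr_arg (Edge.mk (d x) (d y)) ((Category.assoc _ _ _).trans ?_)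
  exact congr_arg (g ≫ ·) (colimit.ι_desc (diagramCocone hs hd x y) e)

end

variable {q} {hq}

/-- The colimit of a diagram of graphs is a colimit. -/
noncomputable def colimitGraphIsColimit (hQ : IsColimit (verticesCocone q hq)) :
    IsColimit (colimitGraphCocone q hq) where
  desc s := colimitGraphDesc s.w (verticesDesc_apply hQ s)
  fac s j := by
    refine hom_ext_edge (verticesDesc_apply hQ s j) (fun a b => ?_)
    refine (Edge.map_comp (colimitGraphι q j) _ _).trans ?_
    exact (congr_arg _ (edge_map_colimitGraphι q ⟨j, a, b, rfl, rfl⟩ (𝟙 _))).trans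
      (edge_map_colimitGraphDesc s.w _ ⟨j, a, b, rfl, rfl⟩ (𝟙 _))
  uniq s (m : colimitGraph q ⟶ _) hm := by
    have h₀ (x : Q) : m.obj x = verticesDesc hQ s x := by
      have : ↾m.obj = hQ.desc ((vertices V).mapCocone s) :=
        hQ.uniq ((vertices V).mapCocone s) (↾m.obj) (fun j => congr_arg (vertices V).map (hm j))
      exact ConcreteCategory.congr_hom this x
    refine hom_ext_mapEq h₀ (fun (x y : Q) => ?_)
    refine colimit.hom_ext (fun e => ?_)
    apply Edge.hom_injective
    refine (Edge.mk_comp_mapEq m (h₀ x) (h₀ y) _).trans ?_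
    have h₁ := edge_map_colimitGraphDesc s.w (verticesDesc_apply hQ s) e (𝟙 _)
    have h₂ := edge_map_colimitGraphι q e (𝟙 _)
    have h₄ : colimitGraphι q e.idx ≫ m = s.ι.app e.idx := hm e.idx
    rw [← h₄, Edge.map_comp] at h₁
    have h₃ := (congr_arg (Edge.map m) h₂).symm.trans h₁.symm
    exact (congr_arg (fun g => Edge.map m (Edge.mk (X := colimitGraph q) x y g))
      (Category.id_comp _).symm).trans (h₃.trans (congr_arg (fun g => Edge.map
        (colimitGraphDesc s.w (verticesDesc_apply hQ s)) (Edge.mk (X := colimitGraph q) x y g))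
          (Category.id_comp _)))

instance : HasColimitsOfSize.{w, w} (EnrichedGraph.{w} V) where
  has_colimits_of_shape _ _ :=
    { has_colimit F := by
        obtain ⟨Q, q, hq, ⟨hQ⟩⟩ := exists_isColimit_verticesCocone F
        exact ⟨⟨⟨_, colimitGraphIsColimit hQ⟩⟩⟩ }

instance : PreservesColimitsOfSize.{w, w} (vertices V) where
  preservesColimitsOfShape :=
    { preservesColimit {F} := by
        obtain ⟨Q, q, hq, ⟨hQ⟩⟩ := exists_isColimit_verticesCocone F
        exact preservesColimit_of_preserves_colimit_cocone (colimitGraphIsColimit hQ) hQ }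

/-- The `C`-edges of the colimit are the disjoint union over `(x, y)` of the sets `Hom(C, colim)`.
When `Hom(C, -)` commutes with each colimit, each piece is the colimit of the edges lying above `(x,
y)`, so descent is done piece by piece. -/
lemma preservesColimit_edges (C : V) (hQ : IsColimit (verticesCocone q hq))
    (H : ∀ x y : Q, PreservesColimit (EdgeIndex.diagram q x y) (coyoneda.obj (op C))) :
    PreservesColimit F (edges C) := by
  refine preservesColimit_of_preserves_colimit_cocone (colimitGraphIsColimit hQ) ?_
  -- A cocone on the sets of edges, restricted to the edges above `(x, y)`.
  let t (s : Cocone (F ⋙ edges C)) (x y : Q) :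
      Cocone (EdgeIndex.diagram q x y ⋙ coyoneda.obj (op C)) :=
    { pt := s.pt
      ι :=
        { app e := ↾fun g => s.ι.app e.idx (Edge.mk e.src e.tgt g)
          naturality e e' f := by
            ext g
            exact Eq.trans (congr_arg (s.ι.app e'.idx) (EdgeIndex.mk_comp_diagramMap f g))
              (ConcreteCategory.congr_hom (s.w f.hom) (Edge.mk e.src e.tgt g)) } }
  let hl (x y : Q) := isColimitOfPreserves (coyoneda.obj (op C))
    (colimit.isColimit (EdgeIndex.diagram q x y))
  let d (s : Cocone (F ⋙ edges C)) (e : Edge C (colimitGraph q)) : s.pt :=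
    (hl e.src e.tgt).desc (t s e.src e.tgt) e.hom
  refine
    { desc s := ↾(d s)
      fac s j := ?_
      uniq s m hm := ?_ }
  · ext ⟨a, b, g⟩
    exact ConcreteCategory.congr_hom ((hl (q j a) (q j b)).fac
      (t s (q j a) (q j b)) ⟨j, a, b, rfl, rfl⟩) g
  · have key (x y : Q) (g : C ⟶ (colimitGraph q).hom x y) :
        m (Edge.mk x y g) = d s (Edge.mk x y g) := by
      refine ConcreteCategory.congr_hom ((hl x y).uniq (t s x y) (↾fun g => m (Edge.mk x y g))
        (fun e => ?_)) g
      ext g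
      refine Eq.trans ?_ (ConcreteCategory.congr_hom (hm e.idx) (Edge.mk e.src e.tgt g))
      exact congr_arg m (edge_map_colimitGraphι q e g).symm
    ext ⟨x, y, g⟩
    exact key x y g

end Colimits

end EnrichedGraph

/-! ### Presentability and connectedness of the point and the edge graphs -/

namespace EnrichedGraph

variable {V : Type u} [Category.{w} V]

/-- Such a colimit is the value at the terminal index, hence absolute. -/
lemma preservesColimit_of_isTerminal {J : Type w} [SmallCategory J] {D : Type*} [Category D]
    {j : J} (hj : IsTerminal j) (F : J ⥤ V) (G : V ⥤ D) : PreservesColimit F G :=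
  preservesColimit_of_preserves_colimit_cocone (colimitOfDiagramTerminal hj F)
    (IsColimit.ofIsoColimit (colimitOfDiagramTerminal hj (F ⋙ G)) (Cocone.ext (Iso.refl _)))

lemma isEmpty_hom_of_isInitial [HasStrictInitialObjects V] {C D : V} (hC : IsEmpty (IsInitial C))
    (hD : IsInitial D) : IsEmpty (C ⟶ D) :=
  ⟨fun f => by
    have := hD.isIso_to f
    exact hC.false (hD.ofIso (asIso f).symm)⟩

section Filtered

variable {J : Type w} [SmallCategory J] {F : J ⥤ EnrichedGraph.{w} V} {Q : Type w}
  {q : ∀ j, (F.obj j).obj → Q}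
  {hq : ∀ {i j : J} (f : i ⟶ j) (a : (F.obj i).obj), q j ((F.map f).obj a) = q i a}

lemma exists_vertex_eq (hQ : IsColimit (verticesCocone q hq)) (x : Q) :
    ∃ (j : J) (a : (F.obj j).obj), q j a = x :=
  Types.jointly_surjective_of_isColimit hQ x

lemma exists_map_obj_eq [IsFiltered J] (hQ : IsColimit (verticesCocone q hq)) {j : J}
    {a b : (F.obj j).obj} (h : q j a = q j b) :
    ∃ (k : J) (f : j ⟶ k), (F.map f).obj a = (F.map f).obj b :=
  (Types.FilteredColimit.isColimit_eq_iff' hQ a b).1 h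

namespace EdgeIndex

/-- The forgetful functor from pairs of vertices to indices. -/
@[simps]
def proj (x y : Q) : EdgeIndex q x y ⥤ J where
  obj e := e.idx
  map f := f.hom

include hq in
lemma nonempty [IsFiltered J] (hQ : IsColimit (verticesCocone q hq)) (x y : Q) :
    Nonempty (EdgeIndex q x y) := by
  obtain ⟨i, a, rfl⟩ := exists_vertex_eq hQ x
  obtain ⟨j, b, rfl⟩ := exists_vertex_eq hQ y
  exact ⟨⟨IsFiltered.max i j, (F.map (IsFiltered.leftToMax i j)).obj a,
    (F.map (IsFiltered.rightToMax i j)).obj b, hq _ _, hq _ _⟩⟩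

/-- The indices of a small diagram have a cocone in `J`. Its vertices need not agree there, but they
have equal images in `Q`, so each pair becomes equal further on; as there are fewer than `κ` pairs,
one stage serves all of them. -/
lemma isCardinalFiltered (κ : Cardinal.{w}) [Fact κ.IsRegular] [IsCardinalFiltered J κ]
    (hQ : IsColimit (verticesCocone q hq)) (x y : Q) :
    IsCardinalFiltered (EdgeIndex q x y) κ where
  nonempty_cocone {A _} G hA := by
    have := isFiltered_of_isCardinalFiltered J κ
    -- A reference pair: its image at a late stage is the vertex of the cocone, including when `A`
    -- is empty.
    obtain ⟨e⟩ := EdgeIndex.nonempty hQ x y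
    let c := IsCardinalFiltered.cocone (G ⋙ proj x y) hA
    let k := IsFiltered.max e.idx c.pt
    let u : e.idx ⟶ k := IsFiltered.leftToMax e.idx c.pt
    let v (i : A) : (G.obj i).idx ⟶ k := c.ι.app i ≫ IsFiltered.rightToMax e.idx c.pt
    have hv {i j : A} (f : i ⟶ j) : (G.map f).hom ≫ v j = v i := by
      have := c.w f
      dsimp at this
      simp only [v, ← this]
      exact (Category.assoc _ _ _).symm
    have H (i : A) : ∃ (l : J) (f : k ⟶ l),
        (F.map f).obj ((F.map (v i)).obj (G.obj i).src) = (F.map f).obj ((F.map u).obj e.src) ∧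
        (F.map f).obj ((F.map (v i)).obj (G.obj i).tgt) = (F.map f).obj ((F.map u).obj e.tgt) := by
      obtain ⟨l, f, hf⟩ := exists_map_obj_eq (a := (F.map (v i)).obj (G.obj i).src)
        (b := (F.map u).obj e.src) hQ (by rw [hq, hq, (G.obj i).hsrc, e.hsrc])
      obtain ⟨m, g, hg⟩ := exists_map_obj_eq (a := (F.map f).obj ((F.map (v i)).obj (G.obj i).tgt))
        (b := (F.map f).obj ((F.map u).obj e.tgt)) hQ
          (by rw [hq, hq, hq, hq, (G.obj i).htgt, e.htgt])
      refine ⟨m, f ≫ g, ?_, ?_⟩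
      · simp [hf]
      · simpa using hg
    choose l f hs ht using H
    obtain ⟨m, a, b, hab⟩ := IsCardinalFiltered.wideSpan f
      (hasCardinalLT_of_hasCardinalLT_arrow hA)
    have key (i : A) {z : (F.obj (G.obj i).idx).obj} {z' : (F.obj e.idx).obj}
        (hz : (F.map (f i)).obj ((F.map (v i)).obj z) = (F.map (f i)).obj ((F.map u).obj z')) :
        (F.map (v i ≫ b)).obj z = (F.map (u ≫ b)).obj z' := by
      rw [← hab i]
      simp [hz]
    refine ⟨⟨⟨m, (F.map (u ≫ b)).obj e.src, (F.map (u ≫ b)).obj e.tgt, ?_, ?_⟩,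
      { app i := ⟨v i ≫ b, key i (hs i), key i (ht i)⟩
        naturality i j g := ?_ }⟩⟩
    · rw [hq, e.hsrc]
    · rw [hq, e.htgt]
    · apply Hom.ext
      refine Eq.trans ?_ (Category.comp_id _).symm
      exact (Category.assoc _ _ _).symm.trans (congr_arg (· ≫ b) (hv g))

end EdgeIndex

end Filtered

section Discrete

variable {I : Type w} {F : Discrete I ⥤ EnrichedGraph.{w} V} {Q : Type w}
  {q : ∀ j, (F.obj j).obj → Q}
  {hq : ∀ {i j : Discrete I} (f : i ⟶ j) (a : (F.obj i).obj), q j ((F.map f).obj a) = q i a}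

/-- Coproducts of sets are disjoint: the comparison with the sigma type recovers both the summand
and the element. -/
lemma exists_map_obj_eq_of_discrete (hQ : IsColimit (verticesCocone q hq)) {i j : Discrete I}
    {a : (F.obj i).obj} {b : (F.obj j).obj} (h : q i a = q j b) :
    ∃ f : i ⟶ j, (F.map f).obj a = b := by
  let s : Cocone (F ⋙ vertices V) :=
    { pt := Σ j : Discrete I, (F.obj j).obj
      ι :=
        { app j := ↾fun a => ⟨j, a⟩
          naturality i j f := by
            obtain ⟨i⟩ := i
            obtain ⟨j⟩ := j
            obtain rfl : i = j := Discrete.eq_of_hom f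
            obtain rfl : f = 𝟙 _ := Subsingleton.elim _ _
            simp } }
  have h₁ : hQ.desc s (q i a) = ⟨i, a⟩ := ConcreteCategory.congr_hom (hQ.fac s i) a
  have h₂ : hQ.desc s (q j b) = ⟨j, b⟩ := ConcreteCategory.congr_hom (hQ.fac s j) b
  have h₃ : (⟨i, a⟩ : Σ j : Discrete I, (F.obj j).obj) = ⟨j, b⟩ := by rw [← h₁, ← h₂, h]
  obtain rfl : i = j := congr_arg Sigma.fst h₃
  obtain rfl : a = b := by simpa using h₃
  exact ⟨𝟙 _, by simp⟩

/-- Over a discrete category, the categories of pairs of vertices have terminal objects when they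
are nonempty. -/
noncomputable def EdgeIndex.isTerminalOfDiscrete (hQ : IsColimit (verticesCocone q hq)) {x y : Q}
    (e : EdgeIndex q x y) : IsTerminal e :=
  have h (e' : EdgeIndex q x y) : Nonempty (e' ⟶ e) := by
    obtain ⟨f, hf⟩ := exists_map_obj_eq_of_discrete hQ (e'.hsrc.trans e.hsrc.symm)
    obtain ⟨g, hg⟩ := exists_map_obj_eq_of_discrete hQ (e'.htgt.trans e.htgt.symm)
    obtain rfl : f = g := Subsingleton.elim _ _
    exact ⟨⟨f, hf, hg⟩⟩
  IsTerminal.ofUniqueHom (fun e' => (h e').some)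
    (fun _ _ => Hom.ext (Subsingleton.elim (α := _ ⟶ _) _ _))

end Discrete

variable [HasColimitsOfSize.{w, w} V]

lemma isCardinalPresentable_point (κ : Cardinal.{w}) [Fact κ.IsRegular] [HasInitial V] :
    IsCardinalPresentable (point V) κ :=
  Functor.isCardinalAccessible_of_natIso coyonedaPointIso κ

lemma isCardinalPresentable_edgeGraph (κ : Cardinal.{w}) [Fact κ.IsRegular] [HasInitial V]
    (C : V) [IsCardinalPresentable C κ] :
    IsCardinalPresentable (edgeGraph C) κ := by
  have : (edges C).IsCardinalAccessible κ :=
    { preservesColimitOfShape J _ _ :=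
        { preservesColimit {F} := by
            obtain ⟨Q, q, hq, ⟨hQ⟩⟩ := exists_isColimit_verticesCocone F
            refine preservesColimit_edges C hQ (fun x y => ?_)
            have := EdgeIndex.isCardinalFiltered κ hQ x y
            have := preservesColimitsOfShape_of_isCardinalPresentable C κ (EdgeIndex q x y)
            infer_instance } }
  exact Functor.isCardinalAccessible_of_natIso (coyonedaEdgeIso C) κ

lemma isConnectedObject_point [HasInitial V] :
    isConnectedObject (EnrichedGraph.{w} V) (point V) := fun _ =>
  preservesColimitsOfShape_of_natIso coyonedaPointIso

/-- By strictness a non-initial `C` has no map to the empty colimit, so both sides are empty. This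
covers pairs of vertices in different summands of a coproduct. -/
lemma preservesColimit_of_isEmpty [HasStrictInitialObjects V] {C : V} (hC : IsEmpty (IsInitial C))
    {J : Type w} [SmallCategory J] [IsEmpty J] (F : J ⥤ V) :
    PreservesColimit F (coyoneda.obj (op C)) := by
  have h : IsInitial (colimit F) :=
    IsInitial.ofUniqueHom (fun X => colimit.desc F ⟨X, { app j := isEmptyElim j
                                                         naturality j := isEmptyElim j }⟩)
      (fun X m => colimit.hom_ext (fun j => isEmptyElim j))
  have := isEmpty_hom_of_isInitial hC h
  refine preservesColimit_of_preserves_colimit_cocone (colimit.isColimit F) ?_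
  exact
    { desc s := ↾fun f => (this.false f).elim
      fac s j := isEmptyElim j
      uniq s m _ := by
        ext f
        exact (this.false f).elim }

/-- Two vertices of a coproduct either come from the same summand, where `EdgeIndex` has a terminal
object, or from different ones, where it is empty. Non-initiality of `C` serves only the second
case. -/
lemma isConnectedObject_edgeGraph [HasInitial V] [HasStrictInitialObjects V] {C : V}
    (hC : IsEmpty (IsInitial C)) :
    isConnectedObject (EnrichedGraph.{w} V) (edgeGraph C) := fun I => by
  have : PreservesColimitsOfShape (Discrete I) (edges C) :=
    { preservesColimit {F} := by
        obtain ⟨Q, q, hq, ⟨hQ⟩⟩ := exists_isColimit_verticesCocone F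
        refine preservesColimit_edges C hQ (fun x y => ?_)
        by_cases h : IsEmpty (EdgeIndex q x y)
        · exact preservesColimit_of_isEmpty hC _
        · rw [not_isEmpty_iff] at h
          obtain ⟨e⟩ := h
          exact preservesColimit_of_isTerminal (EdgeIndex.isTerminalOfDiscrete hQ e) _ _ }
  exact preservesColimitsOfShape_of_natIso (coyonedaEdgeIso C)

end EnrichedGraph

/-! ### Density in terms of compatible families -/

section DenseSubcategories

variable {V : Type u} [Category.{w} V]

/-- The values of a cocone indexed by the objects satisfying `P` over a given object. -/
def coconeApp {P : ObjectProperty V} {X : V} (s : Cocone (CostructuredArrow.proj P.ι X ⋙ P.ι))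
    {A : V} (hA : P A) (p : A ⟶ X) : A ⟶ s.pt :=
  s.ι.app (CostructuredArrow.mk (Y := (⟨A, hA⟩ : P.FullSubcategory)) p)

lemma comp_coconeApp {P : ObjectProperty V} {X : V}
    (s : Cocone (CostructuredArrow.proj P.ι X ⋙ P.ι))
    {A B : V} (hA : P A) (hB : P B) (u : A ⟶ B) (p : B ⟶ X) :
    u ≫ coconeApp s hB p = coconeApp s hA (u ≫ p) := by
  let a : CostructuredArrow P.ι X :=
    CostructuredArrow.mk (Y := (⟨A, hA⟩ : P.FullSubcategory)) (u ≫ p)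
  let b : CostructuredArrow P.ι X := CostructuredArrow.mk (Y := (⟨B, hB⟩ : P.FullSubcategory)) p
  let φ : a ⟶ b := CostructuredArrow.homMk (ObjectProperty.homMk u) rfl
  exact s.w φ

lemma isDense_ι_of_exists_desc (P : ObjectProperty V)
    (desc : ∀ {X : V} (s : Cocone (CostructuredArrow.proj P.ι X ⋙ P.ι)), X ⟶ s.pt)
    (fac : ∀ {X : V} (s : Cocone (CostructuredArrow.proj P.ι X ⋙ P.ι)) {A : V} (hA : P A)
      (p : A ⟶ X), p ≫ desc s = coconeApp s hA p)
    (hom_ext : ∀ {X Y : V} {f g : X ⟶ Y} (_ : ∀ {A : V} (_ : P A) (p : A ⟶ X), p ≫ f = p ≫ g),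
      f = g) : P.ι.IsDense where
  isDenseAt X := ⟨
    { desc s := desc s
      fac s j := by
        refine Eq.trans ?_ (fac s j.left.property j.hom)
        exact congr_arg (· ≫ desc s) (Category.id_comp _)
      uniq s m hm := hom_ext (fun {A} hA p =>
        ((congr_arg (· ≫ m) (Category.id_comp p).symm).trans
          (hm (CostructuredArrow.mk (Y := (⟨A, hA⟩ : P.FullSubcategory)) p))).trans
            (fac s hA p).symm) }⟩

lemma hom_ext_of_isDense_ι (P : ObjectProperty V) [P.ι.IsDense] {X Y : V} {f g : X ⟶ Y}
    (h : ∀ {A : V} (_ : P A) (p : A ⟶ X), p ≫ f = p ≫ g) : f = g :=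
  (P.ι.denseAt X).hom_ext' (fun A p => (Category.id_comp (p ≫ f)).trans
    ((h A.property p).trans (Category.id_comp (p ≫ g)).symm))

lemma exists_desc_of_isDense_ι (P : ObjectProperty V) [P.ι.IsDense] {X Y : V}
    (t : ∀ {A : V} (_ : P A) (_ : A ⟶ X), (A ⟶ Y))
    (ht : ∀ {A B : V} (hA : P A) (hB : P B) (u : A ⟶ B) (p : B ⟶ X),
      u ≫ t hB p = t hA (u ≫ p)) :
    ∃ f : X ⟶ Y, ∀ {A : V} (hA : P A) (p : A ⟶ X), p ≫ f = t hA p := by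
  let s : Cocone (CostructuredArrow.proj P.ι X ⋙ P.ι) :=
    { pt := Y
      ι :=
        { app j := t j.left.property j.hom
          naturality i j φ := by
            refine Eq.trans ?_ (Category.comp_id _).symm
            refine (ht i.left.property j.left.property φ.left.hom j.hom).trans ?_
            exact congr_arg _ (CostructuredArrow.w φ) } }
  refine ⟨(P.ι.denseAt X).desc s, fun {A} hA p => ?_⟩
  refine Eq.trans ?_ ((P.ι.denseAt X).fac s
    (CostructuredArrow.mk (Y := (⟨A, hA⟩ : P.FullSubcategory)) p))
  exact congr_arg (· ≫ (P.ι.denseAt X).desc s) (Category.id_comp _).symm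

/-- This form trades cocones over comma categories for families `t` natural in the objects of `P`,
which are easier to build and restrict. -/
lemma isDense_ι_of_hom (P : ObjectProperty V)
    (desc : ∀ {X Y : V} (t : ∀ {A : V} (_ : P A) (_ : A ⟶ X), (A ⟶ Y))
      (_ : ∀ {A B : V} (hA : P A) (hB : P B) (u : A ⟶ B) (p : B ⟶ X),
        u ≫ t hB p = t hA (u ≫ p)),
      ∃ f : X ⟶ Y, ∀ {A : V} (hA : P A) (p : A ⟶ X), p ≫ f = t hA p)
    (hom_ext : ∀ {X Y : V} {f g : X ⟶ Y} (_ : ∀ {A : V} (_ : P A) (p : A ⟶ X), p ≫ f = p ≫ g),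
      f = g) : P.ι.IsDense := by
  have h {X : V} (s : Cocone (CostructuredArrow.proj P.ι X ⋙ P.ι)) :=
    desc (fun hA p => coconeApp s hA p) (comp_coconeApp s)
  choose d hd using @h
  exact isDense_ι_of_exists_desc P d hd hom_ext

/-- The objects satisfying `P` which are not initial. -/
def nonInitial (P : ObjectProperty V) : ObjectProperty V := fun X => P X ∧ IsEmpty (IsInitial X)

/-- Values on initial objects are forced, so a compatible family on the non-initial ones extends
uniquely. Strictness guarantees that a map out of a non-initial object has a non-initial target,
which keeps the extension compatible. -/
lemma isDense_nonInitial [HasStrictInitialObjects V] (P : ObjectProperty V) [P.ι.IsDense] :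
    (nonInitial P).ι.IsDense := by
  refine isDense_ι_of_hom _ (fun {X Y} t ht => ?_) (fun {X Y f g} h => ?_)
  · classical
    obtain ⟨f, hf⟩ := exists_desc_of_isDense_ι P (X := X) (Y := Y)
      (fun {A} hA p => if h : IsEmpty (IsInitial A) then t ⟨hA, h⟩ p else
        (not_isEmpty_iff.1 h).some.to _) (fun {A B} hA hB u p => by
          by_cases h : IsEmpty (IsInitial A)
          · have hB' : IsEmpty (IsInitial B) := ⟨fun h' =>
              (EnrichedGraph.isEmpty_hom_of_isInitial h h').false u⟩
            rw [dif_pos h, dif_pos hB']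
            exact ht ⟨hA, h⟩ ⟨hB, hB'⟩ u p
          · exact (not_isEmpty_iff.1 h).some.hom_ext _ _)
    exact ⟨f, fun hA p => by rw [hf hA.1, dif_pos hA.2]⟩
  · refine hom_ext_of_isDense_ι P (fun {A} hA p => ?_)
    by_cases hA' : IsEmpty (IsInitial A)
    · exact h ⟨hA, hA'⟩ p
    · exact (not_isEmpty_iff.1 hA').some.hom_ext _ _

end DenseSubcategories

/-! ### Dense families of graphs -/

namespace EnrichedGraph

variable {V : Type u} [Category.{w} V]

lemma edgeOfHom_edgeGraphMap_comp [HasInitial V] {C D : V} (u : C ⟶ D) {X : EnrichedGraph.{w} V}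
    (φ : edgeGraph D ⟶ X) : edgeOfHom (edgeGraphMap u ≫ φ) = (edgeOfHom φ).precomp u := by
  rw [← edgeHom_edgeOfHom φ, edgeGraphMap_comp, edgeOfHom_edgeHom, edgeOfHom_edgeHom]

lemma hom_ext_of_isDense (P : ObjectProperty V) [P.ι.IsDense] {X Y : EnrichedGraph.{w} V}
    {f g : X ⟶ Y} (h₀ : ∀ a, f.obj a = g.obj a)
    (h : ∀ {C : V} (_ : P C) (e : Edge C X), e.map f = e.map g) : f = g := by
  refine hom_ext_mapEq h₀ (fun a b => hom_ext_of_isDense_ι P (fun {A} hA p => ?_))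
  apply Edge.hom_injective
  rw [Edge.mk_comp_mapEq, h hA]
  rfl

/-- The component of a compatible family at `point V` gives the map on vertices, and the components
at the `edgeGraph C` give maps on `C`-edges natural in `C`. Density of `P` in `V` assembles the
latter into hom maps. -/
lemma isDense_of_edgeGraph [HasInitial V] (P : ObjectProperty V) [P.ι.IsDense]
    (W : ObjectProperty (EnrichedGraph.{w} V))
    (h₀ : W (point V)) (h₁ : ∀ {C : V}, P C → W (edgeGraph C)) : W.ι.IsDense := by
  refine isDense_ι_of_hom _ (fun {X Y} t ht => ?_) (fun {X Y f g} h => ?_)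
  · let d (a : X.obj) : Y.obj := (t h₀ (pointHom a)).obj ⟨⟩
    let Φ {C : V} (hC : P C) (e : Edge C X) : Edge C Y := edgeOfHom (t (h₁ hC) (edgeHom e))
    -- Compatibility along the two inclusions of the point in `edgeGraph C` shows that `Φ` respects
    -- endpoints.
    have hs {C : V} (hC : P C) (e : Edge C X) : (Φ hC e).src = d e.src := by
      have := ht h₀ (h₁ hC) (pointHom (X := edgeGraph C) ⟨false⟩) (edgeHom e)
      rw [pointHom_comp (X := edgeGraph C) ⟨false⟩ (edgeHom e)] at this
      exact congr_arg (fun f : point V ⟶ Y => f.obj ⟨⟩) this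
    have ht' {C : V} (hC : P C) (e : Edge C X) : (Φ hC e).tgt = d e.tgt := by
      have := ht h₀ (h₁ hC) (pointHom (X := edgeGraph C) ⟨true⟩) (edgeHom e)
      rw [pointHom_comp (X := edgeGraph C) ⟨true⟩ (edgeHom e)] at this
      exact congr_arg (fun f : point V ⟶ Y => f.obj ⟨⟩) this
    have hΦ {C D : V} (hC : P C) (hD : P D) (u : C ⟶ D) (e : Edge D X) :
        Φ hC (e.precomp u) = (Φ hD e).precomp u := by
      dsimp only [Φ]
      rw [← edgeOfHom_edgeGraphMap_comp, ht (h₁ hC), edgeGraphMap_comp]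
    have H (a b : X.obj) := exists_desc_of_isDense_ι P (X := X.hom a b) (Y := Y.hom (d a) (d b))
      (fun hC g => (Φ hC (Edge.mk a b g)).homOfEq (hs hC _) (ht' hC _)) (fun {C D} hC hD u p => by
        apply Edge.hom_injective
        rw [Edge.mk_comp, Edge.mk_homOfEq, Edge.mk_homOfEq, ← hΦ hC hD]
        rfl)
    choose d₁ hd₁ using H
    let f : X ⟶ Y := { obj := d, map := d₁ }
    have hf {C : V} (hC : P C) (e : Edge C X) : e.map f = Φ hC e :=
      (congr_arg (Edge.mk (d e.src) (d e.tgt)) (hd₁ e.src e.tgt hC e.hom)).trans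
        (Edge.mk_homOfEq (Φ hC e) (hs hC e) (ht' hC e))
    -- `W` may contain further objects `A`; there the equality is tested on the points and edges of
    -- `A`.
    refine ⟨f, fun {A} hA p => hom_ext_of_isDense P (fun a => ?_) (fun {C} hC e => ?_)⟩
    · have := ht h₀ hA (pointHom a) p
      rw [pointHom_comp a p] at this
      exact (congr_arg (fun f : point V ⟶ Y => f.obj ⟨⟩) this).symm
    · rw [Edge.map_comp, hf hC]
      dsimp only [Φ]
      rw [← edgeHom_comp, ← ht (h₁ hC) hA, edgeOfHom_comp, edgeOfHom_edgeHom]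
  · refine hom_ext_of_isDense P (fun a => ?_) (fun {C} hC e => ?_)
    · exact congr_arg (fun f : point V ⟶ Y => f.obj ⟨⟩) (h h₀ (pointHom a))
    · have := congr_arg edgeOfHom (h (h₁ hC) (edgeHom e))
      exact this

end EnrichedGraph

/-! ### Connected objects and local c-presentability -/

section ConnectedObjects

variable {C : Type u} [Category.{w} C]

lemma isConnectedObject_iff (X : C) : isConnectedObject C X ↔
    ∀ (I : Type w) (Y : I → C) (c : Cofan Y) (_ : IsColimit c),
      Function.Bijective (fun (f : Σ i, X ⟶ Y i) => f.2 ≫ c.inj f.1) := by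
  have h {I : Type w} (Y : I → C) (c : Cofan Y) :
      Nonempty (IsColimit ((coyoneda.obj (op X)).mapCocone c)) ↔
        Function.Bijective (fun (f : Σ i, X ⟶ Y i) => f.2 ≫ c.inj f.1) := by
    rw [(Cofan.isColimitMapCoconeEquiv (coyoneda.obj (op X)) Y c).nonempty_congr]
    exact Cofan.nonempty_isColimit_iff_bijective_fromSigma _
  refine ⟨fun hX I Y c hc => ?_, fun hX I => ?_⟩
  · have := hX I
    exact (h Y c).1 ⟨isColimitOfPreserves (coyoneda.obj (op X)) hc⟩
  · exact
      { preservesColimit {K} := by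
          have : PreservesColimit (Discrete.functor (K.obj ∘ Discrete.mk)) (coyoneda.obj (op X)) :=
            ⟨fun {c} hc => (h _ c).2 (hX I _ c hc)⟩
          exact preservesColimit_of_iso_diagram _ Discrete.natIsoFunctor.symm }

/-- Each leg followed by a map into a coproduct selects a summand. The selection is invariant along
arrows of `A`, hence constant, and the factorizations through that summand glue. -/
lemma isConnectedObject_of_isColimit {A : Type w} [SmallCategory A] [IsConnected A] {K : A ⥤ C}
    {c : Cocone K} (hc : IsColimit c) (hK : ∀ a, isConnectedObject C (K.obj a)) :
    isConnectedObject C c.pt := by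
  simp only [isConnectedObject_iff] at hK ⊢
  intro I Y d hd
  have hK' (a : A) := hK a I Y d hd
  constructor
  · rintro ⟨i, f⟩ ⟨j, g⟩ h
    dsimp at h
    have H (a : A) : (⟨i, c.ι.app a ≫ f⟩ : Σ i, K.obj a ⟶ Y i) = ⟨j, c.ι.app a ≫ g⟩ :=
      (hK' a).1 (by simp [h])
    -- Connectedness includes nonemptiness, which provides an index at which to compare summands.
    obtain rfl : i = j := congr_arg Sigma.fst (H (Classical.arbitrary A))
    obtain rfl : f = g := hc.hom_ext (fun a => by simpa using H a)
    rfl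
  · intro f
    choose φ hφ using fun a => (hK' a).2 (c.ι.app a ≫ f)
    have hφ' {a b : A} (u : a ⟶ b) : φ a = ⟨(φ b).1, K.map u ≫ (φ b).2⟩ :=
      (hK' a).1 (by simp [hφ])
    obtain ⟨i, hi⟩ := constant_of_preserves_morphisms' (fun a => (φ a).1)
      (fun a b u => congr_arg Sigma.fst (hφ' u))
    have H (a : A) : ∃ g : K.obj a ⟶ Y i, g ≫ d.inj i = c.ι.app a ≫ f := by
      obtain rfl := hi a
      exact ⟨(φ a).2, hφ a⟩
    choose g hg using H
    let s : Cocone K :=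
      { pt := Y i
        ι :=
          { app := g
            naturality a b u := by
              have : (⟨i, K.map u ≫ g b⟩ : Σ i, K.obj a ⟶ Y i) = ⟨i, g a⟩ :=
                (hK' a).1 (by simp [hg])
              simpa using this } }
    refine ⟨⟨i, hc.desc s⟩, hc.hom_ext (fun a => ?_)⟩
    dsimp
    rw [hc.fac_assoc]
    exact hg a

/-- An initial object is the empty coproduct, and a map into it would have to factor through one of
its summands. -/
lemma isEmpty_hom_of_isConnectedObject {X : C} (hX : isConnectedObject C X) {T : C}
    (hT : IsInitial T) : IsEmpty (X ⟶ T) := by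
  rw [isConnectedObject_iff] at hX
  let c : Cofan (fun i : PEmpty.{w + 1} => (PEmpty.elim i : C)) := Cofan.mk T (fun i => i.elim)
  have hc : IsColimit c := Cofan.IsColimit.mk _ (fun t => hT.to _) (fun _ i => i.elim)
    (fun _ _ _ => hT.hom_ext _ _)
  refine ⟨fun f => ?_⟩
  obtain ⟨⟨i, _⟩, _⟩ := (hX PEmpty _ c hc).2 f
  exact i.elim

lemma exists_small_isDense (P : ObjectProperty C) [ObjectProperty.EssentiallySmall.{w} P]
    [P.ι.IsDense] : ∃ (Q : ObjectProperty C) (_ : ObjectProperty.Small.{w} Q),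
      Q ≤ P ∧ Q.ι.IsDense := by
  obtain ⟨Q, _, h₁, h₂⟩ := ObjectProperty.EssentiallySmall.exists_small_le P
  have := (ObjectProperty.isEquivalence_ιOfLE_iff h₁).2 h₂
  exact ⟨Q, inferInstance, h₁, inferInstanceAs (ObjectProperty.ιOfLE h₁ ⋙ P.ι).IsDense⟩

lemma isStrongGenerator_of_isDense_ι (P : ObjectProperty C) [P.ι.IsDense] :
    P.IsStrongGenerator := by
  have := Functor.isStrongGenerator_of_isDense P.ι
  have h : ObjectProperty.ofObj P.ι.obj = P := by
    ext X
    refine ⟨?_, fun hX => ObjectProperty.ofObj_apply P.ι.obj ⟨X, hX⟩⟩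
    rintro ⟨Y⟩
    exact Y.property
  rwa [h] at this

variable {κ : Cardinal.{w}} [Fact κ.IsRegular]

/-- The shape of the colimits is irrelevant here: small colimits of `S` reaching every object
already make `S` a strong generator. -/
lemma isCardinalLocallyPresentable_of_cPresentable (h : IsCardinalLocallyCPresentable C κ) :
    IsCardinalLocallyPresentable C κ := by
  obtain ⟨S, _, h₁, h₂, h₃⟩ := h.exists_generator
  have := h.toHasColimitsOfSize
  refine (IsCardinalLocallyPresentable.iff_exists_isStrongGenerator C κ).2
    ⟨S, inferInstance, ObjectProperty.IsStrongGenerator.mk_of_exists_colimitsOfShape.{w} (fun X => ?_), h₂⟩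
  obtain ⟨J, _, _, hJ⟩ := h₃ X
  exact ⟨J, inferInstance, hJ⟩

/-- Write the source `A` as a colimit of connected objects. Any object of the diagram would map to
the initial object, which is impossible; so the diagram is empty and `A` is initial. -/
lemma hasStrictInitialObjects_of_cPresentable (h : IsCardinalLocallyCPresentable C κ) :
    HasStrictInitialObjects C where
  out {I A} f hI := by
    obtain ⟨S, _, h₁, h₂, h₃⟩ := h.exists_generator
    obtain ⟨J, _, _, ⟨p⟩⟩ := h₃ A
    have hJ : IsEmpty J := ⟨fun j =>
      (isEmpty_hom_of_isConnectedObject (h₁ _ (p.prop_diag_obj j)) hI).false (p.ι.app j ≫ f)⟩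
    have hA : IsInitial A := IsInitial.ofUniqueHom
      (fun X => p.isColimit.desc ⟨X, { app j := isEmptyElim j, naturality j := isEmptyElim j }⟩)
      (fun X m => p.isColimit.hom_ext (fun j => isEmptyElim j))
    exact ⟨hI.to _, hA.hom_ext _ _, hI.hom_ext _ _⟩

/-- The connected `κ`-presentable objects are closed under `κ`-small connected colimits. The slice
over `X` therefore has such colimits, so it is `κ`-c-filtered, and density makes `X` the colimit of
its canonical diagram. -/
lemma isCardinalLocallyCPresentable_of_isDense [HasColimitsOfSize.{w, w} C]
    [ObjectProperty.EssentiallySmall.{w} (isCardinalPresentable C κ)]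
    [(isConnectedObject C ⊓ isCardinalPresentable C κ).ι.IsDense] :
    IsCardinalLocallyCPresentable C κ where
  exists_generator := by
    let W : ObjectProperty C := isConnectedObject C ⊓ isCardinalPresentable C κ
    have : ObjectProperty.EssentiallySmall.{w} W := ObjectProperty.EssentiallySmall.of_le inf_le_right
    obtain ⟨Q, _, hQ₁, hQ₂⟩ := ObjectProperty.EssentiallySmall.exists_small_le W
    refine ⟨Q, inferInstance, hQ₁.trans inf_le_left, hQ₁.trans inf_le_right, fun X => ?_⟩
    let e := equivSmallModel.{w} (CostructuredArrow W.ι X)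
    refine ⟨SmallModel.{w} (CostructuredArrow W.ι X), inferInstance, ⟨fun {A _ _} F hA => ?_⟩, ?_⟩
    · have : W.IsClosedUnderColimitsOfShape A :=
        ⟨fun Y ⟨p⟩ => ⟨isConnectedObject_of_isColimit p.isColimit (fun a => (p.prop_diag_obj a).1),
          have : (isCardinalPresentable C κ).IsClosedUnderColimitsOfShape A :=
            isClosedUnderColimitsOfShape_isCardinalPresentable.{w} C hA
          ObjectProperty.prop_of_isColimit _ p.isColimit (fun a => (p.prop_diag_obj a).2)⟩⟩
      exact ⟨e.inverse.mapCoconeInv (colimit.cocone (F ⋙ e.inverse))⟩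
    -- The canonical diagram takes values in `W`, that is, in `Q` up to isomorphism.
    · rw [← ObjectProperty.colimitsOfShape_isoClosure]
      refine ObjectProperty.colimitsOfShape_monotone _ hQ₂ _ ⟨
        { diag := _
          ι := _
          isColimit := (W.ι.denseAt X).whiskerEquivalence e.symm
          prop_diag_obj j := ?_ }⟩
      exact ObjectProperty.FullSubcategory.property _

end ConnectedObjects

/-! ### Local presentability of the category of graphs -/

namespace EnrichedGraph

variable {V : Type u} [Category.{w} V] {κ : Cardinal.{w}} [Fact κ.IsRegular]

variable (V) in
lemma hasInitial_of_hasColimitsOfSize [HasColimitsOfSize.{w, w} V] : HasInitial V :=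
  have := hasColimitsOfSizeShrink.{0, 0, w, w} V
  inferInstance

/-- The point and the edges of shapes satisfying `P`. -/
noncomputable def generators [HasInitial V] (P : ObjectProperty V) :
    ObjectProperty (EnrichedGraph.{w} V) :=
  .ofObj (fun _ : PUnit.{w + 1} => point V) ⊔ .ofObj (fun C : Subtype P => edgeGraph C.1)

lemma isDense_generators [HasInitial V] (P : ObjectProperty V) [P.ι.IsDense] :
    (generators P).ι.IsDense :=
  isDense_of_edgeGraph P _ (Or.inl (ObjectProperty.ofObj_apply _ ⟨⟩))
    (fun {C} hC => Or.inr (ObjectProperty.ofObj_apply (fun C : Subtype P => edgeGraph C.1) ⟨C, hC⟩))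

theorem isCardinalLocallyPresentable (h : IsCardinalLocallyPresentable V κ) :
    IsCardinalLocallyPresentable (EnrichedGraph.{w} V) κ := by
  have : HasInitial V := hasInitial_of_hasColimitsOfSize V
  obtain ⟨Q, _, hQ, _⟩ := exists_small_isDense (isCardinalPresentable V κ)
  have := isDense_generators Q
  refine (IsCardinalLocallyPresentable.iff_exists_isStrongGenerator _ κ).2
    ⟨generators Q, ?_, isStrongGenerator_of_isDense_ι _, ?_⟩
  · dsimp only [generators]
    infer_instance
  · rintro _ (⟨⟨⟩⟩ | ⟨C, hC⟩)
    · exact isCardinalPresentable_point κ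
    · have : IsCardinalPresentable C κ := hQ _ hC
      exact isCardinalPresentable_edgeGraph κ C

theorem isCardinalLocallyCPresentable (h : IsCardinalLocallyPresentable V κ)
    (hV : HasStrictInitialObjects V) :
    IsCardinalLocallyCPresentable (EnrichedGraph.{w} V) κ := by
  have : HasInitial V := hasInitial_of_hasColimitsOfSize V
  have := isCardinalLocallyPresentable h
  have := isDense_nonInitial (isCardinalPresentable V κ)
  have := isDense_of_edgeGraph (nonInitial (isCardinalPresentable V κ))
    (isConnectedObject _ ⊓ isCardinalPresentable _ κ)
    ⟨isConnectedObject_point, isCardinalPresentable_point κ⟩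
    (fun {C} hC => ⟨isConnectedObject_edgeGraph hC.2,
      have : IsCardinalPresentable C κ := hC.1
      isCardinalPresentable_edgeGraph κ C⟩)
  exact isCardinalLocallyCPresentable_of_isDense

/-- An initial graph maps to the graph without vertices, so it has none, and neither does any graph
mapping to it. Nothing is asked of `V`, which is why a second application of `𝒢` always yields
c-presentability. -/
lemma hasStrictInitialObjects : HasStrictInitialObjects (EnrichedGraph.{w} V) where
  out {I A} f hI := by
    let E : EnrichedGraph.{w} V := { obj := PEmpty, hom a := a.elim }
    have hI' : IsEmpty I.obj := ⟨fun a => ((hI.to E).obj a).elim⟩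
    have hA : IsEmpty A.obj := ⟨fun a => hI'.false (f.obj a)⟩
    have ext {X Y : EnrichedGraph.{w} V} (_ : IsEmpty X.obj) (f g : X ⟶ Y) : f = g :=
      hom_ext_edge (fun a => isEmptyElim a) (fun a => isEmptyElim a)
    exact ⟨hI.to _, ext hA _ _, ext hI' _ _⟩

end EnrichedGraph

/-! ### Discrete graphs and connected components -/

namespace EnrichedGraph

variable {V : Type u} [Category.{w} V]

section Discrete

variable [HasTerminal V] [HasInitial V]

variable (V) in
open Classical in
/-- The hom objects of the discrete graph on a set of vertices: terminal on the diagonal, initial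
off the diagonal. -/
noncomputable def discreteHom {I : Type w} (i j : I) : V :=
  if i = j then ⊤_ V else ⊥_ V

/-- The diagonal hom objects of a discrete graph are terminal. -/
noncomputable def discreteHomSelfIso {I : Type w} (i : I) : ⊤_ V ≅ discreteHom V i i :=
  eqToIso (if_pos rfl).symm

/-- The off-diagonal hom objects of a discrete graph are initial. -/
noncomputable def isInitialDiscreteHom {I : Type w} {i j : I} (h : i ≠ j) :
    IsInitial (discreteHom V i j) :=
  initialIsInitial.ofIso (eqToIso (if_neg h).symm)

instance [HasStrictInitialObjects V] {I : Type w} (A : V) (i j : I) :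
    Subsingleton (A ⟶ discreteHom V i j) where
  allEq f g := by
    by_cases h : i = j
    · subst h
      rw [← cancel_mono (discreteHomSelfIso i).inv]
      exact terminalIsTerminal.hom_ext _ _
    · have := (isInitialDiscreteHom (V := V) h).isIso_to f
      exact ((isInitialDiscreteHom (V := V) h).ofIso (asIso f).symm).hom_ext _ _

lemma nonempty_hom_discreteHom {I : Type w} {A : V} {i j : I}
    (h : IsEmpty (IsInitial A) → i = j) : Nonempty (A ⟶ discreteHom V i j) := by
  by_cases hA : IsEmpty (IsInitial A)
  · obtain rfl := h hA
    exact ⟨terminal.from A ≫ (discreteHomSelfIso i).hom⟩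
  · simp only [not_isEmpty_iff] at hA
    exact ⟨hA.some.to _⟩

lemma eq_of_hom_discreteHom [HasStrictInitialObjects V] {I : Type w} {A : V} {i j : I}
    (f : A ⟶ discreteHom V i j) (hA : IsEmpty (IsInitial A)) : i = j := by
  by_contra h
  exact (isEmpty_hom_of_isInitial hA (isInitialDiscreteHom h)).false f

variable (V) in
/-- The discrete graph on a set: the coproduct of copies of the terminal graph. -/
noncomputable abbrev discreteGraph (I : Type w) : EnrichedGraph.{w} V where
  obj := I
  hom := discreteHom V

variable (V) in
/-- The terminal graph. -/
noncomputable abbrev terminalGraph : EnrichedGraph.{w} V where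
  obj := PUnit
  hom _ _ := ⊤_ V

variable (V) in
/-- The graph `terminalGraph V` is terminal. -/
noncomputable def isTerminalTerminalGraph : IsTerminal (terminalGraph.{w} V) :=
  IsTerminal.ofUniqueHom
    (fun X => { obj := fun _ => PUnit.unit, map := fun a b => terminal.from (X.hom a b) })
    (fun X f => Hom.ext rfl (heq_of_eq (by
      ext)))

lemma discreteGraph_hom_ext [HasStrictInitialObjects V] {I : Type w} {X : EnrichedGraph.{w} V}
    {f g : X ⟶ discreteGraph V I} (h : ∀ a, f.obj a = g.obj a) : f = g :=
  hom_ext_mapEq h (fun _ _ => Subsingleton.elim _ _)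

/-- The morphism to a discrete graph given by a function on vertices which identifies the
endpoints of every edge. -/
noncomputable def toDiscrete {I : Type w} {X : EnrichedGraph.{w} V} (f : X.obj → I)
    (hf : ∀ a b, IsEmpty (IsInitial (X.hom a b)) → f a = f b) : X ⟶ discreteGraph V I where
  obj := f
  map a b := (nonempty_hom_discreteHom (hf a b)).some

lemma eq_of_isEmpty_isInitial_discreteHom {I : Type w} {i j : I}
    (h : IsEmpty (IsInitial (discreteHom V i j))) : i = j := by
  by_contra h'
  exact h.false (isInitialDiscreteHom h')

variable (V) in
/-- The functor sending a set to the discrete graph on this set. -/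
noncomputable def discreteFunctor [HasStrictInitialObjects V] : Type w ⥤ EnrichedGraph.{w} V where
  obj I := discreteGraph V I
  map f := toDiscrete (fun i => f i)
    (fun _ _ h => congr_arg (fun i => f i) (eq_of_isEmpty_isInitial_discreteHom h))
  map_id _ := discreteGraph_hom_ext (fun _ => rfl)
  map_comp _ _ := discreteGraph_hom_ext (fun _ => rfl)

/-- The inclusion of the vertex `i` in a discrete graph. -/
noncomputable def discreteInclusion {I : Type w} (i : I) :
    terminalGraph.{w} V ⟶ discreteGraph V I where
  obj _ := i
  map _ _ := (discreteHomSelfIso i).hom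

lemma discreteInclusion_hom_ext {I : Type w} {X : EnrichedGraph.{w} V}
    {f g : discreteGraph V I ⟶ X} (h : ∀ i, discreteInclusion i ≫ f = discreteInclusion i ≫ g) :
    f = g := by
  have h₀ (i : I) : f.obj i = g.obj i := congr_arg (fun k => Hom.obj k PUnit.unit) (h i)
  refine hom_ext_mapEq h₀ (fun i j => ?_)
  by_cases hij : i = j
  · subst hij
    rw [← cancel_epi (discreteHomSelfIso i).hom]
    have e := congr_arg (fun k => Edge.map k (Edge.mk PUnit.unit PUnit.unit (𝟙 (⊤_ V)))) (h i)
    simp only [Edge.map, comp_map, Category.id_comp] at e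
    exact Edge.hom_injective ((Edge.mk_comp_mapEq f (h₀ i) (h₀ i) _).trans e)
  · exact (isInitialDiscreteHom hij).hom_ext _ _

/-- The morphism from a discrete graph given by a family of loops. -/
noncomputable def discreteDesc {I : Type w} {X : EnrichedGraph.{w} V}
    (f : I → (terminalGraph.{w} V ⟶ X)) : discreteGraph V I ⟶ X where
  obj i := (f i).obj PUnit.unit
  map i j := by
    classical
    exact if h : i = j then
      eqToHom (by rw [h]) ≫ (discreteHomSelfIso i).inv ≫ (f i).map PUnit.unit PUnit.unit ≫
        eqToHom (by rw [h])
    else (isInitialDiscreteHom h).to _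

lemma discreteInclusion_desc {I : Type w} {X : EnrichedGraph.{w} V}
    (f : I → (terminalGraph.{w} V ⟶ X)) (i : I) : discreteInclusion i ≫ discreteDesc f = f i :=
  Hom.ext rfl (heq_of_eq (by
    ext a b
    simp [discreteDesc, discreteInclusion]))

lemma discreteInclusion_map [HasStrictInitialObjects V] {I I' : Type w} (u : I ⟶ I') (i : I) :
    discreteInclusion i ≫ (discreteFunctor V).map u = discreteInclusion (u i) :=
  discreteGraph_hom_ext (fun _ => rfl)

variable (V) in
/-- The discrete graph functor is left adjoint to the global sections functor. -/
noncomputable def discreteAdjunction [HasStrictInitialObjects V] :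
    discreteFunctor V ⊣ coyoneda.obj (op (terminalGraph.{w} V)) :=
  Adjunction.mkOfHomEquiv
    { homEquiv I X :=
        { toFun f := ↾(fun i => discreteInclusion i ≫ f)
          invFun g := discreteDesc (fun i => g i)
          left_inv f := discreteInclusion_hom_ext (fun i => discreteInclusion_desc _ i)
          right_inv g := by
            ext i
            exact discreteInclusion_desc _ i }
      homEquiv_naturality_left_symm u g := discreteInclusion_hom_ext (fun i =>
        (discreteInclusion_desc _ i).trans 
          (((Category.assoc _ _ _).symm.trans
            (congr_arg (fun k => k ≫ discreteDesc (fun i => g i)) (discreteInclusion_map u i))).trans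
            (discreteInclusion_desc _ (u i))).symm)
      homEquiv_naturality_right f g := by
        ext i
        exact (Category.assoc _ _ _).symm }

/-- The connected components of a graph: the quotient of the set of vertices by the equivalence
relation generated by the existence of a non-initial hom object. -/
def components (X : EnrichedGraph.{w} V) : Type w :=
  Quot (fun a b : X.obj => IsEmpty (IsInitial (X.hom a b)))

/-- Functions on connected components are morphisms to discrete graphs. -/
noncomputable def componentsEquiv [HasStrictInitialObjects V] (X : EnrichedGraph.{w} V)
    (I : Type w) : (components X ⟶ I) ≃ (X ⟶ (discreteFunctor V).obj I) where
  toFun f := toDiscrete (fun a => f (Quot.mk _ a))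
    (fun _ _ h => congr_arg (fun i => f i) (Quot.sound h))
  invFun g := ↾(Quot.lift g.obj (fun a b h => eq_of_hom_discreteHom (g.map a b) h))
  left_inv f := by
    ext ⟨a⟩
    rfl
  right_inv g := discreteGraph_hom_ext (fun _ => rfl)

instance [HasStrictInitialObjects V] : (discreteFunctor.{w} V).IsRightAdjoint :=
  ⟨_, ⟨Adjunction.adjunctionOfEquivLeft (G := discreteFunctor.{w} V) componentsEquiv
    (fun _ _ _ _ _ => discreteGraph_hom_ext (fun _ => rfl))⟩⟩

end Discrete

end EnrichedGraph

lemma hasStrictInitialObjects_of_equivalence {C : Type u} [Category.{w} C] {D : Type*}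
    [Category* D] (e : C ≌ D) [HasStrictInitialObjects D] : HasStrictInitialObjects C where
  out f hI := by
    have := (hI.isInitialObj e.functor).isIso_to (e.functor.map f)
    exact isIso_of_reflects_iso f e.functor

/-! ### The site with an adjoined vertex -/

/-- The objects of the category obtained from `D` by adjoining an object `vertex` together with
two morphisms from `vertex` to each object of `D`. -/
inductive WithVertex (D : Type w) : Type w
  | vertex : WithVertex D
  | edge (c : D) : WithVertex D

namespace WithVertex

variable {D : Type w} [SmallCategory D]

/-- The morphisms of `WithVertex D`. -/
inductive Hom : WithVertex D → WithVertex D → Type w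
  | id : Hom vertex vertex
  | endpoint (b : Bool) (c : D) : Hom vertex (edge c)
  | edge {c d : D} (f : c ⟶ d) : Hom (edge c) (edge d)

namespace Hom

/-- The identities of `WithVertex D`. -/
def refl : ∀ X : WithVertex D, Hom X X
  | vertex => id
  | .edge c => edge (𝟙 c)

/-- The composition of `WithVertex D`. -/
def comp : ∀ {X Y Z : WithVertex D}, Hom X Y → Hom Y Z → Hom X Z
  | _, _, _, id, g => g
  | _, _, _, endpoint b _, edge (d := d) _ => endpoint b d
  | _, _, _, edge f, edge g => edge (f ≫ g)

end Hom

instance : SmallCategory (WithVertex D) where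
  Hom := Hom
  id := Hom.refl
  comp := Hom.comp
  id_comp f := by
    cases f <;> simp [Hom.refl, Hom.comp]
  comp_id f := by
    cases f <;> simp [Hom.refl, Hom.comp]
  assoc f g h := by
    cases f <;> cases g <;> cases h <;> simp [Hom.comp]

/-- The morphism from `vertex` selecting one of the endpoints of an edge: the source for `false`
and the target for `true`. -/
abbrev endpoint (b : Bool) (c : D) : vertex ⟶ edge c := Hom.endpoint b c

/-- The morphism of `WithVertex D` given by a morphism of `D`. -/
abbrev edgeMap {c d : D} (f : c ⟶ d) : edge c ⟶ edge d := Hom.edge f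

section Presheaf

variable (P : (WithVertex D)ᵒᵖ ⥤ Type w)

/-- The restriction of an element of a presheaf on `WithVertex D` to one of its endpoints. -/
abbrev endpointOf {P : (WithVertex D)ᵒᵖ ⥤ Type w} (b : Bool) {c : D}
    (x : P.obj (op (edge c))) : P.obj (op vertex) :=
  P.map (endpoint b c).op x

lemma endpointOf_map {P : (WithVertex D)ᵒᵖ ⥤ Type w} (b : Bool) {c d : D} (f : c ⟶ d)
    (x : P.obj (op (edge d))) : endpointOf b (P.map (edgeMap f).op x) = endpointOf b x :=
  (Functor.map_comp_apply P _ _ x).symm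

/-- The presheaf of elements with given endpoints. -/
def homPresheaf (a b : P.obj (op vertex)) : Dᵒᵖ ⥤ Type w where
  obj c := { x : P.obj (op (edge c.unop)) // endpointOf false x = a ∧ endpointOf true x = b }
  map f := ↾(fun x => ⟨P.map (edgeMap f.unop).op x.1,
    (endpointOf_map _ _ _).trans x.2.1, (endpointOf_map _ _ _).trans x.2.2⟩)
  map_id c := by
    refine ConcreteCategory.hom_ext _ _ (fun x => Subtype.ext ?_)
    exact Functor.map_id_apply P _ x.1
  map_comp f g := by
    refine ConcreteCategory.hom_ext _ _ (fun x => Subtype.ext ?_)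
    exact Functor.map_comp_apply P (edgeMap f.unop).op (edgeMap g.unop).op x.1

end Presheaf

end WithVertex

/-! ### The nerve of a graph -/

namespace EnrichedGraph

open WithVertex

variable {V : Type u} [Category.{w} V] {D : Type w} [SmallCategory D] (F : V ⥤ Dᵒᵖ ⥤ Type w)

/-- A section over `c` of one of the presheaves given by the hom objects of a `V`-graph. -/
structure Sec (c : D) (X : EnrichedGraph.{w} V) : Type w where
  /-- the source vertex -/
  src : X.obj
  /-- the target vertex -/
  tgt : X.obj
  /-- the underlying section -/
  val : (F.obj (X.hom src tgt)).obj (op c)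

namespace Sec

variable {F}

/-- The image of a section under a morphism of graphs. -/
def map {c : D} {X Y : EnrichedGraph.{w} V} (f : X ⟶ Y) (e : Sec F c X) : Sec F c Y where
  src := f.obj e.src
  tgt := f.obj e.tgt
  val := (F.map (f.map e.src e.tgt)).app _ e.val

/-- The restriction of a section. -/
def res {c d : D} (u : c ⟶ d) {X : EnrichedGraph.{w} V} (e : Sec F d X) : Sec F c X where
  src := e.src
  tgt := e.tgt
  val := (F.obj _).map u.op e.val

lemma val_injective {c : D} {X : EnrichedGraph.{w} V} {a b : X.obj}
    {x y : (F.obj (X.hom a b)).obj (op c)} (h : (Sec.mk a b x : Sec F c X) = Sec.mk a b y) :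
    x = y := by
  simpa using h

/-- The underlying element of a section, when its vertices are known up to equality. -/
def valOfEq {c : D} {X : EnrichedGraph.{w} V} (e : Sec F c X) {a b : X.obj}
    (ha : e.src = a) (hb : e.tgt = b) : (F.obj (X.hom a b)).obj (op c) :=
  ha ▸ hb ▸ e.val

lemma mk_valOfEq {c : D} {X : EnrichedGraph.{w} V} (e : Sec F c X) {a b : X.obj}
    (ha : e.src = a) (hb : e.tgt = b) : Sec.mk a b (e.valOfEq ha hb) = e := by
  subst ha hb
  rfl

lemma res_map {c d : D} (u : c ⟶ d) {X Y : EnrichedGraph.{w} V} (f : X ⟶ Y) (e : Sec F d X) :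
    (e.res u).map f = (e.map f).res u := by
  simp only [res, map]
  congr 1
  exact NatTrans.naturality_apply (F.map (f.map e.src e.tgt)) u.op e.val

lemma res_id {c : D} {X : EnrichedGraph.{w} V} (e : Sec F c X) : e.res (𝟙 c) = e := by
  obtain ⟨a, b, x⟩ := e
  simp [res]

lemma res_comp {c d e : D} (u : c ⟶ d) (v : d ⟶ e) {X : EnrichedGraph.{w} V} (x : Sec F e X) :
    x.res (u ≫ v) = (x.res v).res u := by
  simp only [res, op_comp, Functor.map_comp]
  rfl

lemma map_id {c : D} {X : EnrichedGraph.{w} V} (e : Sec F c X) : e.map (𝟙 X) = e := by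
  simp [map]

lemma map_comp {c : D} {X Y Z : EnrichedGraph.{w} V} (f : X ⟶ Y) (g : Y ⟶ Z)
    (e : Sec F c X) : e.map (f ≫ g) = (e.map f).map g := by
  simp only [map, comp_map, Functor.map_comp]
  rfl

/-- The endpoints of a section: the source for `false` and the target for `true`. -/
def vert {c : D} {X : EnrichedGraph.{w} V} (e : Sec F c X) : Bool → X.obj
  | false => e.src
  | true => e.tgt

lemma vert_map {c : D} {X Y : EnrichedGraph.{w} V} (f : X ⟶ Y) (e : Sec F c X) (b : Bool) :
    (e.map f).vert b = f.obj (e.vert b) := by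
  cases b <;> rfl

end Sec

/-- The values of the nerve of a graph. -/
def nerveObj (X : EnrichedGraph.{w} V) : WithVertex D → Type w
  | vertex => X.obj
  | edge c => Sec F c X

/-- The restriction maps of the nerve of a graph. -/
def nerveMap (X : EnrichedGraph.{w} V) :
    ∀ {c d : WithVertex D}, WithVertex.Hom c d → nerveObj F X d → nerveObj F X c
  | _, _, .id, x => x
  | _, _, .endpoint b _, x => Sec.vert x b
  | _, _, .edge f, x => Sec.res f x

lemma nerveMap_comp (X : EnrichedGraph.{w} V) {c d e : WithVertex D} (f : c ⟶ d) (g : d ⟶ e)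
    (x : nerveObj F X e) : nerveMap F X (f ≫ g) x = nerveMap F X f (nerveMap F X g x) := by
  obtain _ | ⟨b, c⟩ | u := f
  · rfl
  · obtain _ | _ | v := g
    cases b <;> rfl
  · obtain _ | _ | v := g
    exact Sec.res_comp u v x

/-- The presheaf on `WithVertex D` associated to a graph: its value at `vertex` is the set of
vertices, and its value at an object of `D` is the set of sections of the hom objects. -/
def nervePresheaf (X : EnrichedGraph.{w} V) : (WithVertex D)ᵒᵖ ⥤ Type w where
  obj c := nerveObj F X c.unop
  map f := ↾(nerveMap F X f.unop)
  map_id c := by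
    refine ConcreteCategory.hom_ext _ _ (fun x => ?_)
    obtain ⟨_ | c⟩ := c
    · rfl
    · exact Sec.res_id x
  map_comp {c d e} f g := by
    refine ConcreteCategory.hom_ext _ _ (fun x => ?_)
    exact nerveMap_comp F X g.unop f.unop x

variable {F} in
/-- The map induced on nerves by a morphism of graphs. -/
def nerveObjMap {X Y : EnrichedGraph.{w} V} (f : X ⟶ Y) :
    ∀ c : WithVertex D, nerveObj F X c → nerveObj F Y c
  | vertex => f.obj
  | edge _ => Sec.map f

lemma nerveObjMap_naturality {X Y : EnrichedGraph.{w} V} (f : X ⟶ Y) {c d : WithVertex D}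
    (u : c ⟶ d) (x : nerveObj F X d) :
    nerveObjMap f c (nerveMap F X u x) = nerveMap F Y u (nerveObjMap f d x) := by
  obtain _ | ⟨b, c⟩ | u := u
  · rfl
  · exact (Sec.vert_map f x b).symm
  · exact Sec.res_map u f x

/-- The functor sending a graph to its associated presheaf on `WithVertex D`. -/
def nerve : EnrichedGraph.{w} V ⥤ (WithVertex D)ᵒᵖ ⥤ Type w where
  obj := nervePresheaf F
  map {X Y} f :=
    { app c := ↾(nerveObjMap f c.unop)
      naturality c d u := by
        refine ConcreteCategory.hom_ext _ _ (fun x => ?_)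
        exact nerveObjMap_naturality F f u.unop x }
  map_id X := by
    ext ⟨_ | c⟩ x
    · rfl
    · exact Sec.map_id x
  map_comp f g := by
    ext ⟨_ | c⟩ x
    · rfl
    · exact Sec.map_comp f g x

end EnrichedGraph

namespace EnrichedGraph

open WithVertex

variable {V : Type u} [Category.{w} V] {D : Type w} [SmallCategory D] (F : V ⥤ Dᵒᵖ ⥤ Type w)

variable {F} in
lemma hom_ext_sec [F.Faithful] {X Y : EnrichedGraph.{w} V} {f g : X ⟶ Y}
    (h₀ : ∀ a, f.obj a = g.obj a) (h : ∀ (c : D) (e : Sec F c X), e.map f = e.map g) : f = g := by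
  obtain ⟨f₀, f₁⟩ := f
  obtain ⟨g₀, g₁⟩ := g
  obtain rfl : f₀ = g₀ := funext h₀
  congr
  ext a b
  apply F.map_injective
  ext c x
  exact Sec.val_injective (h c.unop ⟨a, b, x⟩)

-- As `f₁` respects endpoints, it restricts to a map of presheaves for each pair of vertices, and
-- fullness of `F` lifts that map to `V`.
variable {F} in
lemma exists_hom_of_sec [F.Full] {X Y : EnrichedGraph.{w} V} (f₀ : X.obj → Y.obj)
    (f₁ : ∀ c : D, Sec F c X → Sec F c Y)
    (h₀ : ∀ (c : D) (e : Sec F c X) (b : Bool), (f₁ c e).vert b = f₀ (e.vert b))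
    (h₁ : ∀ (c d : D) (u : c ⟶ d) (e : Sec F d X), f₁ c (e.res u) = (f₁ d e).res u) :
    ∃ f : X ⟶ Y, (∀ a, f.obj a = f₀ a) ∧ ∀ (c : D) (e : Sec F c X), e.map f = f₁ c e := by
  let φ (a b : X.obj) : F.obj (X.hom a b) ⟶ F.obj (Y.hom (f₀ a) (f₀ b)) :=
    { app c := ↾(fun x => (f₁ c.unop ⟨a, b, x⟩).valOfEq (h₀ _ _ false) (h₀ _ _ true))
      naturality c d u := by
        refine ConcreteCategory.hom_ext _ _ (fun x => ?_)
        apply Sec.val_injective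
        refine (Sec.mk_valOfEq _ _ _).trans ((h₁ _ _ u.unop ⟨a, b, x⟩).trans ?_)
        exact (congr_arg (Sec.res u.unop)
          (Sec.mk_valOfEq (f₁ c.unop ⟨a, b, x⟩) (h₀ _ _ false) (h₀ _ _ true))).symm }
  refine ⟨{ obj := f₀, map := fun a b => F.preimage (φ a b) }, fun _ => rfl, fun c e => ?_⟩
  obtain ⟨a, b, x⟩ := e
  simp only [Sec.map, F.map_preimage]
  exact Sec.mk_valOfEq _ _ _

instance [F.Faithful] : (nerve F).Faithful where
  map_injective h := hom_ext_sec (F := F)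
    (fun a => ConcreteCategory.congr_hom (NatTrans.congr_app h (op vertex)) a)
    (fun c e => ConcreteCategory.congr_hom (NatTrans.congr_app h (op (edge c))) e)

instance [F.Full] : (nerve F).Full where
  map_surjective {X Y} φ := by
    obtain ⟨f, h₀, h₁⟩ := exists_hom_of_sec (F := F) (X := X) (Y := Y)
      (fun a => φ.app (op vertex) a) (fun c e => φ.app (op (edge c)) e)
      (fun c e b => (NatTrans.naturality_apply φ (endpoint b c).op e).symm)
      (fun c d u e => NatTrans.naturality_apply φ (edgeMap u).op e)
    refine ⟨f, ?_⟩
    ext ⟨_ | c⟩ x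
    · exact h₀ x
    · exact h₁ c x

/-- The sections of the nerve of a graph with given endpoints are the sections of the
corresponding hom object. -/
def homPresheafNerveIso (X : EnrichedGraph.{w} V) (a b : X.obj) :
    homPresheaf ((nerve F).obj X) a b ≅ F.obj (X.hom a b) :=
  NatIso.ofComponents (fun c => Equiv.toIso
      { toFun x := Sec.valOfEq (F := F) x.1 x.2.1 x.2.2
        invFun x := ⟨Sec.mk a b x, rfl, rfl⟩
        left_inv x := Subtype.ext (Sec.mk_valOfEq (F := F) x.1 x.2.1 x.2.2)
        right_inv x := rfl })
    (fun {c d} u => by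
      refine ConcreteCategory.hom_ext _ _ (fun x => ?_)
      apply Sec.val_injective (F := F)
      exact (Sec.mk_valOfEq _ _ _).trans
        (congr_arg (Sec.res u.unop) (Sec.mk_valOfEq (F := F) x.1 x.2.1 x.2.2)).symm)

-- The set `P (edge c)` is the disjoint union, over pairs of endpoints, of the values at `c` of the
-- `homPresheaf P a b`. Preimages of these under `F` are the homs of the required graph.
variable {F} in
lemma nerve_essImage {P : (WithVertex D)ᵒᵖ ⥤ Type w}
    (hP : ∀ a b, F.essImage (homPresheaf P a b)) : (nerve F).essImage P := by
  let X : EnrichedGraph.{w} V :=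
    { obj := P.obj (op vertex)
      hom a b := (hP a b).witness }
  let α (a b : X.obj) : F.obj (X.hom a b) ≅ homPresheaf P a b := (hP a b).getIso
  have hα (a b : X.obj) {c d : D} (u : c ⟶ d) (x : (F.obj (X.hom a b)).obj (op d)) :
      ((α a b).hom.app (op c) ((F.obj (X.hom a b)).map u.op x)).1 =
        P.map (edgeMap u).op ((α a b).hom.app (op d) x).1 :=
    congr_arg Subtype.val (NatTrans.naturality_apply (α a b).hom u.op x)
  let φ₁ (c : D) (e : Sec F c X) : P.obj (op (edge c)) := ((α e.src e.tgt).hom.app (op c) e.val).1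
  have hφ₁ (c : D) : Function.Bijective (φ₁ c) := by
    refine ⟨fun ⟨a, b, x⟩ ⟨a', b', x'⟩ h => ?_, fun y => ?_⟩
    · have ha : a = a' := ((α a b).hom.app (op c) x).2.1.symm.trans
        ((congr_arg (endpointOf false) h).trans ((α a' b').hom.app (op c) x').2.1)
      have hb : b = b' := ((α a b).hom.app (op c) x).2.2.symm.trans
        ((congr_arg (endpointOf true) h).trans ((α a' b').hom.app (op c) x').2.2)
      subst ha hb
      exact congr_arg (Sec.mk a b)
        (((α a b).app (op c)).toEquiv.injective (Subtype.ext h))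
    · refine ⟨⟨endpointOf false y, endpointOf true y,
        (α (endpointOf false y) (endpointOf true y)).inv.app (op c) ⟨y, rfl, rfl⟩⟩, ?_⟩
      exact congr_arg Subtype.val (((α (endpointOf false y) (endpointOf true y)).app
        (op c)).toEquiv.apply_symm_apply ⟨y, rfl, rfl⟩)
  let φ₀ : ∀ c : WithVertex D, nerveObj F X c → P.obj (op c)
    | vertex => fun a => a
    | edge c => φ₁ c
  have hφ₀ : ∀ c : WithVertex D, Function.Bijective (φ₀ c)
    | vertex => Function.bijective_id
    | edge c => hφ₁ c
  have hφ {c d : WithVertex D} (u : c ⟶ d) (x : nerveObj F X d) :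
      φ₀ c (nerveMap F X u x) = P.map u.op (φ₀ d x) := by
    obtain _ | ⟨b, c⟩ | u := u
    · exact (Functor.map_id_apply P _ x).symm
    · cases b
      · exact ((α x.src x.tgt).hom.app (op c) x.val).2.1.symm
      · exact ((α x.src x.tgt).hom.app (op c) x.val).2.2.symm
    · exact hα _ _ u x.val
  exact ⟨X, ⟨NatIso.ofComponents (fun c => (Equiv.ofBijective _ (hφ₀ c.unop)).toIso)
    (fun u => ConcreteCategory.hom_ext _ _ (fun x => hφ u.unop x))⟩⟩

end EnrichedGraph

/-! ### The topology on the site with an adjoined vertex -/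

namespace WithVertex

variable {D : Type w} [SmallCategory D]

/-- The restriction to `D` of a sieve on an object of `D` in `WithVertex D`. -/
def edgeSieve {c : D} (S : Sieve (edge c)) : Sieve c where
  arrows _ f := S.arrows (edgeMap f)
  downward_closed {_ _ f} hf g := S.downward_closed (f := edgeMap f) hf (edgeMap g)

/-- The covering sieves on the objects of `WithVertex D`. -/
def coveringSieves (J : GrothendieckTopology D) : ∀ X : WithVertex D, Set (Sieve X)
  | vertex => {⊤}
  | edge c => {S | (∀ b, S.arrows (endpoint b c)) ∧ edgeSieve S ∈ J c}

/-- The topology on `WithVertex D` associated to a topology on `D`: a sieve on an object of `D` is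
covering when it contains both endpoints and its restriction to `D` is covering. -/
def topology (J : GrothendieckTopology D) : GrothendieckTopology (WithVertex D) where
  sieves := coveringSieves J
  top_mem' X := by
    obtain _ | c := X
    · exact rfl
    · exact ⟨fun _ => trivial, J.top_mem c⟩
  pullback_stable' {X Y S} f hS := by
    obtain _ | ⟨b, c⟩ | ⟨f⟩ := f
    · obtain rfl : S = ⊤ := hS
      exact Sieve.pullback_top
    -- Only the maximal sieve covers `vertex`, and the pullback along an endpoint is maximal because
    -- covering sieves contain the endpoints.
    · exact Sieve.id_mem_iff_eq_top.1 (hS.1 b)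
    · exact ⟨fun b => hS.1 b, J.pullback_stable f hS.2⟩
  transitive' {X S} hS R hR := by
    obtain _ | c := X
    · obtain rfl : S = ⊤ := hS
      simpa using hR (f := 𝟙 _) trivial
    · refine ⟨fun b => ?_, J.transitive hS.2 _ (fun _ f hf => (hR hf).2)⟩
      exact Sieve.id_mem_iff_eq_top.2 (hR (hS.1 b) : R.pullback (endpoint b c) = ⊤)

variable {J : GrothendieckTopology D} {P : (WithVertex D)ᵒᵖ ⥤ Type w}

/-- The sieve on an object of `D` in `WithVertex D` generated by a sieve in `D` and both
endpoints. -/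
def extendSieve {c : D} (T : Sieve c) : Sieve (edge c) where
  arrows
    | vertex, _ => True
    | edge _, .edge f => T.arrows f
  downward_closed := by
    rintro _ _ (_ | _ | f) hf (_ | _ | g)
    · trivial
    · trivial
    · exact T.downward_closed hf g

/-- The members of a compatible family at the two endpoints fix a pair `(a, b)`, and the other
members then form a family in the single presheaf `homPresheaf P a b`. -/
lemma isSheafFor_of_homPresheaf {c : D} (S : Sieve (edge c)) (hS : ∀ b, S.arrows (endpoint b c))
    (h : ∀ a b, Presieve.IsSheafFor (homPresheaf P a b) (edgeSieve S).arrows) :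
    Presieve.IsSheafFor P S.arrows := by
  intro x hx
  rw [Presieve.compatible_iff_sieveCompatible] at hx
  have hv (b : Bool) {d : D} (f : d ⟶ c) (hf : S.arrows (edgeMap f)) :
      endpointOf b (x _ hf) = x _ (hS b) := (hx _ (endpoint b d) hf).symm
  let y : Presieve.FamilyOfElements (homPresheaf P (x _ (hS false)) (x _ (hS true)))
      (edgeSieve S).arrows := fun d f hf => ⟨x (edgeMap f) hf, hv _ f hf, hv _ f hf⟩
  have hy : y.Compatible := by
    rw [Presieve.compatible_iff_sieveCompatible]
    exact fun _ _ f g hf => Subtype.ext (hx _ (edgeMap g) hf)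
  obtain ⟨t, ht, ht'⟩ := h _ _ y hy
  refine ⟨t.1, fun Y f hf => ?_, fun t' h' => ?_⟩
  · obtain _ | ⟨b, c⟩ | ⟨f⟩ := f
    · cases b
      · exact t.2.1
      · exact t.2.2
    · exact congr_arg Subtype.val (ht f hf)
  · exact congr_arg Subtype.val (ht' ⟨t', h' _ (hS false), h' _ (hS true)⟩
      (fun d f hf => Subtype.ext (h' _ hf)))

/-- Conversely, a family in `homPresheaf P a b` becomes one for `P` on the larger sieve by taking
`a` and `b` as its values at the endpoints. -/
lemma homPresheaf_isSheafFor {c : D} (T : Sieve c) (h : Presieve.IsSheafFor P (extendSieve T).arrows)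
    (a b : P.obj (op vertex)) : Presieve.IsSheafFor (homPresheaf P a b) T.arrows := by
  intro x hx
  rw [Presieve.compatible_iff_sieveCompatible] at hx
  let y : Presieve.FamilyOfElements P (extendSieve T).arrows
    | vertex, .endpoint false _, _ => a
    | vertex, .endpoint true _, _ => b
    | edge _, .edge f, hf => (x f hf).1
  have hy : y.Compatible := by
    rw [Presieve.compatible_iff_sieveCompatible]
    rintro _ _ (_ | ⟨b, c⟩ | f) (_ | ⟨b', _⟩ | g) hf
    · cases b <;> exact (Functor.map_id_apply P _ _).symm
    · cases b'
      · exact (x f hf).2.1.symm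
      · exact (x f hf).2.2.symm
    · exact congr_arg Subtype.val (hx f g hf)
  obtain ⟨t, ht, ht'⟩ := h y hy
  refine ⟨⟨t, ht (endpoint false c) trivial, ht (endpoint true c) trivial⟩,
    fun d f hf => Subtype.ext (ht (edgeMap f) hf), fun t' h' => Subtype.ext (ht' _ ?_)⟩
  rintro _ (_ | ⟨b, c⟩ | f) hf
  · cases b
    · exact t'.2.1
    · exact t'.2.2
  · exact congr_arg Subtype.val (h' f hf)

lemma isSheaf_topology_iff :
    Presheaf.IsSheaf (topology J) P ↔ ∀ a b, Presheaf.IsSheaf J (homPresheaf P a b) := by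
  simp only [isSheaf_iff_isSheaf_of_type]
  refine ⟨fun h a b c T hT => homPresheaf_isSheafFor T (h _ ⟨fun _ => trivial, hT⟩) a b,
    fun h X S hS => ?_⟩
  obtain _ | c := X
  · obtain rfl : S = ⊤ := hS
    exact Presieve.isSheafFor_top _
  · exact isSheafFor_of_homPresheaf S hS.1 (fun a b => h a b _ hS.2)

end WithVertex

/-! ### Toposes of graphs -/

namespace EnrichedGraph

open WithVertex

variable {V : Type u} [Category.{w} V]

lemma hasInitial_of_finitaryPreExtensive (C : Type*) [Category* C] [FinitaryPreExtensive C] :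
    HasInitial C :=
  inferInstance

theorem isPresheafTopos (h : IsPresheafTopos V) : IsPresheafTopos (EnrichedGraph.{w} V) := by
  obtain ⟨D, _, ⟨e⟩⟩ := h
  have : (nerve e.functor).EssSurj :=
    ⟨fun _ => nerve_essImage (fun _ _ => Functor.EssSurj.mem_essImage e.functor _)⟩
  have : (nerve e.functor).IsEquivalence := { }
  exact ⟨WithVertex D, inferInstance, ⟨(nerve e.functor).asEquivalence⟩⟩

theorem isGrothendieckTopos (h : IsGrothendieckTopos V) :
    IsGrothendieckTopos (EnrichedGraph.{w} V) := by
  obtain ⟨D, _, J, ⟨e⟩⟩ := h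
  let F := e.functor ⋙ sheafToPresheaf J (Type w)
  let G : EnrichedGraph.{w} V ⥤ Sheaf (topology J) (Type w) :=
    ObjectProperty.lift _ (nerve F) (fun X => isSheaf_topology_iff.2 (fun a b =>
      (Presheaf.isSheaf_of_iso_iff (homPresheafNerveIso F X a b)).2
        (e.functor.obj (X.hom a b)).property))
  have hG : G.FullyFaithful :=
    (Functor.FullyFaithful.ofFullyFaithful (nerve F)).ofCompFaithful (G := sheafToPresheaf _ _)
  have := hG.full
  have := hG.faithful
  have : G.EssSurj := ⟨fun P => by
    -- The hom presheaves of a sheaf are sheaves for `J`, hence lie in the essential image of `F`.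
    obtain ⟨X, ⟨i⟩⟩ := nerve_essImage (F := F) (P := P.obj) (fun a b => by
      let Q : Sheaf J (Type w) := ⟨homPresheaf P.obj a b, isSheaf_topology_iff.1 P.property a b⟩
      exact ⟨e.inverse.obj Q, ⟨(sheafToPresheaf J (Type w)).mapIso (e.counitIso.app Q)⟩⟩)
    exact ⟨X, ⟨(fullyFaithfulSheafToPresheaf _ _).preimageIso i⟩⟩⟩
  have : G.IsEquivalence := { }
  exact ⟨WithVertex D, inferInstance, topology J, ⟨G.asEquivalence⟩⟩

theorem isLocallyConnectedGrothendieckTopos (h : IsGrothendieckTopos V) :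
    IsLocallyConnectedGrothendieckTopos (EnrichedGraph.{w} V) := by
  refine ⟨isGrothendieckTopos h, ?_⟩
  obtain ⟨D, _, J, ⟨e⟩⟩ := h
  have : HasTerminal V := Adjunction.hasLimitsOfShape_of_equivalence e.functor
  -- Extensivity of the sheaf category makes its initial object strict; this is transported to `V`
  -- along `e`.
  have : FinitaryExtensive (Sheaf J (Type w)) := inferInstance
  have : HasInitial (Sheaf J (Type w)) := hasInitial_of_finitaryPreExtensive _
  have : HasInitial V := Adjunction.hasColimitsOfShape_of_equivalence e.functor
  have : HasStrictInitialObjects V := hasStrictInitialObjects_of_equivalence e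
  exact ⟨terminalGraph V, isTerminalTerminalGraph V, discreteFunctor V, discreteAdjunction V,
    inferInstance⟩

end EnrichedGraph

theorem mainTheorem10 {V : Type u} [Category.{w} V] (κ : Cardinal.{w}) [Fact κ.IsRegular] :
    (IsCardinalLocallyPresentable V κ →
      IsCardinalLocallyPresentable (EnrichedGraph.{w} V) κ) ∧
    (IsCardinalLocallyPresentable V κ → HasStrictInitialObjects V →
      IsCardinalLocallyCPresentable (EnrichedGraph.{w} V) κ) ∧
    (IsCardinalLocallyPresentable V κ →
      IsCardinalLocallyCPresentable (EnrichedGraph.{w} (EnrichedGraph.{w} V)) κ) ∧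
    (IsCardinalLocallyCPresentable V κ →
      IsCardinalLocallyCPresentable (EnrichedGraph.{w} V) κ) ∧
    (IsPresheafTopos V → IsPresheafTopos (EnrichedGraph.{w} V)) ∧
    (IsGrothendieckTopos V → IsLocallyConnectedGrothendieckTopos (EnrichedGraph.{w} V)) := by
  refine ⟨EnrichedGraph.isCardinalLocallyPresentable,
    EnrichedGraph.isCardinalLocallyCPresentable, fun h => ?_, fun h => ?_,
    EnrichedGraph.isPresheafTopos, EnrichedGraph.isLocallyConnectedGrothendieckTopos⟩
  · exact EnrichedGraph.isCardinalLocallyCPresentable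
      (EnrichedGraph.isCardinalLocallyPresentable h) EnrichedGraph.hasStrictInitialObjects
  · exact EnrichedGraph.isCardinalLocallyCPresentable
      (isCardinalLocallyPresentable_of_cPresentable h)
      (hasStrictInitialObjects_of_cPresentable h)
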